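/- Let $M$ be a smooth manifold (finite-dimensional, Hausdorff, second countable, without boundary), let $\tau:E\to M$ be a smooth vector bundle of finite rank with a Lie algebroid structure, and let $\rho:E\to TM$ be its anchor. For $r\ge 0$ let $T^rE$ be the $r$-th order tangent manifold of $E$, i.e. the manifold of $r$-jets $[a]^r$ at $0$ of smooth curves $a$ in $E$ defined on an open interval around $0$. Such a curve is called admissible if $\rho(a(t))=\dot\gamma(t)$ for all $t$, where $\gamma=\tau\circ a$. For $k\ge 1$ put $$E^k=\{[a]^{k-1}\in T^{k-1}E \mid a \text{ is an admissible curve in } E\},$$ and for $k>l>0$ let $\tau_{k,l}:E^k\to E^l$, $[a]^{k-1}\mapsto[a]^{l-1}$, be the restriction of the jet projection $T^{k-1}E\to T^{l-1}E$. Then for every $k\ge 1$ the set $E^k$ is an (embedded) smooth submanifold of $T^{k-1}E$, of dimension $$\dim E^k=\dim M+k\cdot\operatorname{rank}E .$$ For all $k>l>0$ the map $\tau_{k,l}:E^k\to E^l$ is a smooth fibre bundle, with typical fibre $\mathbb{R}^{(k-l)\operatorname{rank}E}$. For $k=l+1$ it is an affine bundle: $E^l$ is covered by the base sets of smooth local trivializations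 of $\tau_{l+1,l}$ with typical fibre $\mathbb{R}^{\operatorname{rank}E}$ such that any two of them differ on each fibre by an affine isomorphism, and such that each of them identifies each fibre affinely with an affine subspace of the corresponding fibre of the affine bundle $T^{l}E\to T^{l-1}E$. -/

import Mathlib

open Set Filter Topology Bundle Module
open scoped Manifold ContDiff

noncomputable section

namespace JetBundle

section Jets

variable {E : Type*} [NormedAddCommGroup E] [NormedSpace ℝ E]
  {H : Type*} [TopologicalSpace H] (I : ModelWithCorners ℝ E H)
  (N : Type*) [TopologicalSpace N] [ChartedSpace H N]

/-- A smooth curve in `N` defined near `0 ∈ ℝ` (values far from `0` are irrelevant). -/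
structure Curve where
  toFun : ℝ → N
  smooth : ∀ᶠ t in 𝓝 (0 : ℝ), ContMDiffAt 𝓘(ℝ, ℝ) I ∞ toFun t

variable {I N}

/-- The derivatives at `0` of orders `0, …, r` of a curve, read in the chart `e`. -/
def Curve.derivs (r : ℕ) (e : OpenPartialHomeomorph N H) (γ : Curve I N) : Fin (r + 1) → E :=
  fun j => iteratedDeriv j (fun t => I (e (γ.toFun t))) 0

variable (I N) in
/-- Two curves have the same `r`-jet at `0`: they start at the same point, and their derivatives
at `0` up to order `r` in the chart at that point agree. -/
def jetSetoid (r : ℕ) : Setoid (Curve I N) where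
  r γ δ := γ.toFun 0 = δ.toFun 0 ∧
    γ.derivs r (chartAt H (γ.toFun 0)) = δ.derivs r (chartAt H (γ.toFun 0))
  iseqv := by
    refine ⟨fun _ => ⟨rfl, rfl⟩, fun h => ⟨h.1.symm, ?_⟩, fun h k => ⟨h.1.trans k.1, ?_⟩⟩
    · rw [← h.1]; exact h.2.symm
    · rw [h.2, h.1]; exact k.2

variable (I N) in
/-- The `r`-th order tangent manifold `T^r N`: the set of `r`-jets at `0` of curves in `N`. -/
def HigherTangent (r : ℕ) : Type _ := Quotient (jetSetoid I N r)

/-- The `r`-jet `[γ]^r` at `0` of a curve `γ`. -/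
def jet (r : ℕ) (γ : Curve I N) : HigherTangent I N r := Quotient.mk (jetSetoid I N r) γ

namespace HigherTangent

/-- The point `γ(0)` of a jet `[γ]^r`. -/
def base {r : ℕ} : HigherTangent I N r → N := Quotient.lift (fun γ => γ.toFun 0) fun _ _ h => h.1

@[simp] lemma base_jet {r : ℕ} (γ : Curve I N) : base (jet r γ) = γ.toFun 0 := rfl

/-- The natural coordinates of a jet `[γ]^r` induced by a chart `e` around `γ(0)`:
the derivatives at `0` of orders `0, …, r` of `γ` in this chart
(see `coord_jet` for the independence of the representative). -/
def coord {r : ℕ} (e : OpenPartialHomeomorph N H) (p : HigherTangent I N r) : Fin (r + 1) → E :=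
  (Quotient.out p).derivs r e

/-- The projection `T^r N → T^s N`, `[γ]^r ↦ [γ]^s`, for `s ≤ r`. -/
def proj {r s : ℕ} (h : s ≤ r) : HigherTangent I N r → HigherTangent I N s :=
  Quotient.map id fun _ _ hγ => ⟨hγ.1, funext fun j =>
    congrFun hγ.2 ⟨j, lt_of_lt_of_le j.2 (Nat.succ_le_succ h)⟩⟩

@[simp] lemma proj_jet {r s : ℕ} (h : s ≤ r) (γ : Curve I N) : proj h (jet r γ) = jet s γ := rfl

end HigherTangent

/-! ### The charts of `T^r N` -/

lemma Curve.contDiffAt_chart [IsManifold I ∞ N] (γ : Curve I N) {e : OpenPartialHomeomorph N H}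
    (he : e ∈ IsManifold.maximalAtlas I ∞ N) (hγ : γ.toFun 0 ∈ e.source) :
    ContDiffAt ℝ ∞ (fun t => I (e (γ.toFun t))) 0 := by
  have h1 : ContMDiffAt 𝓘(ℝ, ℝ) I ∞ γ.toFun 0 := γ.smooth.self_of_nhds
  have h2 := (contMDiffAt_of_mem_maximalAtlas he hγ).comp (0 : ℝ) h1
  exact ((I.contMDiff (n := ∞)).contMDiffAt.comp (0 : ℝ) h2).contDiffAt

lemma contDiffAt_transition [IsManifold I ∞ N] [I.Boundaryless] {e e' : OpenPartialHomeomorph N H}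
    (he : e ∈ IsManifold.maximalAtlas I ∞ N) (he' : e' ∈ IsManifold.maximalAtlas I ∞ N)
    {x : E} (h : I.symm x ∈ e.target) (h' : e.symm (I.symm x) ∈ e'.source) :
    ContDiffAt ℝ ∞ (fun x => I (e' (e.symm (I.symm x)))) x := by
  have h1 : ContMDiffAt 𝓘(ℝ, E) I ∞ I.symm x :=
    (I.contMDiffOn_symm (n := ∞)).contMDiffAt (by rw [I.range_eq_univ]; exact univ_mem)
  have h2 : ContMDiffAt I I ∞ e.symm (I.symm x) := contMDiffAt_symm_of_mem_maximalAtlas he h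
  have h3 : ContMDiffAt I I ∞ e' (e.symm (I.symm x)) := contMDiffAt_of_mem_maximalAtlas he' h'
  have h4 : ContMDiffAt 𝓘(ℝ, E) I ∞ (fun x => e.symm (I.symm x)) x := h2.comp x h1
  have h5 : ContMDiffAt 𝓘(ℝ, E) I ∞ (fun x => e' (e.symm (I.symm x))) x := h3.comp x h4
  have h6 : ContMDiffAt 𝓘(ℝ, E) 𝓘(ℝ, E) ∞ (fun x => I (e' (e.symm (I.symm x)))) x :=
    ((I.contMDiff (n := ∞)).contMDiffAt (x := e' (e.symm (I.symm x)))).comp x h5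
  exact h6.contDiffAt

/-- Faà di Bruno: the change of coordinates on jets. -/
def changeCoord (r : ℕ) (g : E → E) (v : Fin (r + 1) → E) : Fin (r + 1) → E := fun i =>
  ∑ c : OrderedFinpartition (i : ℕ), iteratedFDeriv ℝ c.length g (v 0) fun j =>
    v ⟨c.partSize j, lt_of_le_of_lt (c.partSize_le j) i.2⟩

lemma Curve.derivs_change [IsManifold I ∞ N] [I.Boundaryless] (r : ℕ) (γ : Curve I N)
    {e e' : OpenPartialHomeomorph N H}
    (he : e ∈ IsManifold.maximalAtlas I ∞ N) (he' : e' ∈ IsManifold.maximalAtlas I ∞ N)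
    (h : γ.toFun 0 ∈ e.source) (h' : γ.toFun 0 ∈ e'.source) :
    γ.derivs r e' = changeCoord r (fun x => I (e' (e.symm (I.symm x)))) (γ.derivs r e) := by
  have hc := γ.contDiffAt_chart he h
  have hg : ContDiffAt ℝ ∞ (fun x => I (e' (e.symm (I.symm x)))) (I (e (γ.toFun 0))) :=
    contDiffAt_transition he he' (by simpa using e.map_source h) (by simpa [h] using h')
  funext i
  have hev : (fun t => I (e' (γ.toFun t))) =ᶠ[𝓝 0]
      (fun x => I (e' (e.symm (I.symm x)))) ∘ fun t => I (e (γ.toFun t)) := by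
    have hcont : ContinuousAt γ.toFun 0 := γ.smooth.self_of_nhds.continuousAt
    filter_upwards [hcont.eventually (e.open_source.mem_nhds h)] with t ht
    simp [e.left_inv ht]
  change iteratedDeriv i (fun t => I (e' (γ.toFun t))) 0 = _
  rw [hev.iteratedDeriv_eq, iteratedDeriv_vcomp_eq_sum_orderedFinpartition hg hc
    (by exact_mod_cast le_top)]
  simp [changeCoord, Curve.derivs]

lemma contDiffOn_changeCoord (r : ℕ) {g : E → E} {U : Set E} (hU : IsOpen U)
    (hg : ContDiffOn ℝ ∞ g U) :
    ContDiffOn ℝ ∞ (changeCoord r g) {v : Fin (r + 1) → E | v 0 ∈ U} := by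
  rw [contDiffOn_pi]
  intro i
  refine ContDiffOn.sum fun c _ => ?_
  intro v hv
  refine ContDiffAt.contDiffWithinAt ?_
  have hgv : ContDiffAt ℝ ∞ g (v 0) := hg.contDiffAt (hU.mem_nhds hv)
  have h1 : ContDiffAt ℝ ∞ (fun v : Fin (r + 1) → E => iteratedFDeriv ℝ c.length g (v 0)) v :=
    (hgv.iteratedFDeriv_right (m := ∞) (by exact_mod_cast le_top)).comp v
      (contDiff_apply ℝ E (0 : Fin (r + 1))).contDiffAt
  have h2 : ContDiffAt ℝ ∞ (fun (v : Fin (r + 1) → E) (j : Fin c.length) =>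
      v ⟨c.partSize j, lt_of_le_of_lt (c.partSize_le j) i.2⟩) v :=
    (contDiff_pi.2 fun j => contDiff_apply ℝ E _).contDiffAt
  have hev : ContDiffAt ℝ ∞ (fun q : (E [×c.length]→L[ℝ] E) × (Fin c.length → E) => q.1 q.2)
      (iteratedFDeriv ℝ c.length g (v 0),
        fun j => v ⟨c.partSize j, lt_of_le_of_lt (c.partSize_le j) i.2⟩) :=
    ((ContinuousLinearMap.id ℝ
      (E [×c.length]→L[ℝ] E)).cpolynomialAt_uncurry_of_multilinear).contDiffAt
  exact hev.comp v (h1.prodMk h2)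

/-- The polynomial curve with prescribed derivatives at `0`. -/
def polyCurve {r : ℕ} (v : Fin (r + 1) → E) (t : ℝ) : E :=
  ∑ j : Fin (r + 1), (t ^ (j : ℕ)) • (((Nat.factorial j : ℝ)⁻¹) • v j)

lemma contDiff_polyCurve {r : ℕ} (v : Fin (r + 1) → E) : ContDiff ℝ ∞ (polyCurve v) := by
  unfold polyCurve; fun_prop

lemma iteratedDeriv_polyCurve {r : ℕ} (v : Fin (r + 1) → E) (i : Fin (r + 1)) :
    iteratedDeriv i (polyCurve v) 0 = v i := by
  unfold polyCurve
  rw [iteratedDeriv_fun_sum (fun j _ => by fun_prop)]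
  simp (disch := fun_prop) only [iteratedDeriv_smul_const, iteratedDeriv_fun_pow_zero]
  rw [Finset.sum_eq_single i]
  · simp [smul_smul, Nat.factorial_ne_zero]
  · intro j _ hj
    rw [if_neg (fun h => hj (Fin.ext h.symm))]; simp
  · simp

lemma polyCurve_zero {r : ℕ} (v : Fin (r + 1) → E) : polyCurve v 0 = v 0 := by
  simpa using iteratedDeriv_polyCurve v 0

open Classical in
/-- The curve which is polynomial in the chart `e`, with derivatives `v` at `0`. -/
def curveOf [IsManifold I ∞ N] [I.Boundaryless] {r : ℕ} (e : OpenPartialHomeomorph N H)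
    (he : e ∈ IsManifold.maximalAtlas I ∞ N) (v : Fin (r + 1) → E) : Curve I N :=
  if hv : I.symm (v 0) ∈ e.target then
    { toFun := fun t => e.symm (I.symm (polyCurve v t))
      smooth := by
        have hc : Continuous fun t => I.symm (polyCurve v t) :=
          I.continuous_symm.comp (contDiff_polyCurve v).continuous
        have h0 : I.symm (polyCurve v 0) ∈ e.target := by rwa [polyCurve_zero]
        filter_upwards [hc.continuousAt.eventually (e.open_target.mem_nhds h0)] with t ht
        have h1 : ContMDiffAt 𝓘(ℝ, ℝ) 𝓘(ℝ, E) ∞ (polyCurve v) t :=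
          (contDiff_polyCurve v).contMDiff.contMDiffAt
        have h2 : ContMDiffAt 𝓘(ℝ, E) I ∞ I.symm (polyCurve v t) :=
          (I.contMDiffOn_symm (n := ∞)).contMDiffAt
            (by rw [I.range_eq_univ]; exact univ_mem)
        exact (contMDiffAt_symm_of_mem_maximalAtlas he ht).comp t (h2.comp t h1) }
  else
    { toFun := fun _ => e.symm (I.symm (v 0))
      smooth := Eventually.of_forall fun _ => contMDiffAt_const }

section Charts

variable [IsManifold I ∞ N] [I.Boundaryless]

lemma curveOf_zero {r : ℕ} {e : OpenPartialHomeomorph N H}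
    (he : e ∈ IsManifold.maximalAtlas I ∞ N) (v : Fin (r + 1) → E) :
    (curveOf (I := I) e he v).toFun 0 = e.symm (I.symm (v 0)) := by
  unfold curveOf
  split_ifs <;> simp [polyCurve_zero]

lemma derivs_curveOf {r : ℕ} {e : OpenPartialHomeomorph N H}
    (he : e ∈ IsManifold.maximalAtlas I ∞ N) {v : Fin (r + 1) → E}
    (hv : I.symm (v 0) ∈ e.target) : (curveOf (I := I) e he v).derivs r e = v := by
  funext i
  have hc : Continuous fun t => I.symm (polyCurve v t) :=
    I.continuous_symm.comp (contDiff_polyCurve v).continuous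
  have h0 : I.symm (polyCurve v 0) ∈ e.target := by rwa [polyCurve_zero]
  have hev : (fun t => I (e ((curveOf (I := I) e he v).toFun t))) =ᶠ[𝓝 0] polyCurve v := by
    filter_upwards [hc.continuousAt.eventually (e.open_target.mem_nhds h0)] with t ht
    have hr : polyCurve v t ∈ range I := by rw [I.range_eq_univ]; exact mem_univ _
    simp only [curveOf, dif_pos hv]
    rw [e.right_inv ht, I.right_inv hr]
  exact (hev.iteratedDeriv_eq _).trans (iteratedDeriv_polyCurve v i)

lemma jet_eq_iff {r : ℕ} {γ δ : Curve I N} {e : OpenPartialHomeomorph N H}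
    (he : e ∈ IsManifold.maximalAtlas I ∞ N) (h : γ.toFun 0 ∈ e.source) :
    jet r γ = jet r δ ↔ γ.toFun 0 = δ.toFun 0 ∧ γ.derivs r e = δ.derivs r e := by
  have hat := IsManifold.chart_mem_maximalAtlas (I := I) (n := ∞) (γ.toFun 0)
  have hs := mem_chart_source H (γ.toFun 0)
  constructor
  · intro hj
    obtain ⟨h1, h2⟩ : γ.toFun 0 = δ.toFun 0 ∧ γ.derivs r (chartAt H (γ.toFun 0)) =
      δ.derivs r (chartAt H (γ.toFun 0)) := Quotient.exact hj
    refine ⟨h1, ?_⟩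
    rw [γ.derivs_change r hat he hs h, h2, ← δ.derivs_change r hat he (h1 ▸ hs) (h1 ▸ h)]
  · rintro ⟨h1, h2⟩
    refine Quotient.sound (s := jetSetoid I N r) ⟨h1, ?_⟩
    rw [γ.derivs_change r he hat h hs, h2, ← δ.derivs_change r he hat (h1 ▸ h) (h1 ▸ hs)]

namespace HigherTangent

lemma coord_jet {r : ℕ} {γ : Curve I N} {e : OpenPartialHomeomorph N H}
    (he : e ∈ IsManifold.maximalAtlas I ∞ N) (h : γ.toFun 0 ∈ e.source) :
    coord e (jet r γ) = γ.derivs r e :=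
  ((jet_eq_iff he h).1 (Quotient.out_eq (jet r γ)).symm).2.symm

/-- The chart of `T^r N` induced by a chart `e` of `N`: it is defined on the jets `[γ]^r` with
`γ(0)` in the domain of `e`, and it is given by the natural coordinates. -/
def chart (r : ℕ) (e : OpenPartialHomeomorph N H) (he : e ∈ IsManifold.maximalAtlas I ∞ N) :
    PartialEquiv (HigherTangent I N r) (Fin (r + 1) → E) where
  toFun := coord e
  invFun v := jet r (curveOf e he v)
  source := {p | p.base ∈ e.source}
  target := {v | I.symm (v 0) ∈ e.target}
  map_source' := by
    intro p
    refine Quotient.inductionOn p fun γ hγ => ?_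
    change γ.toFun 0 ∈ e.source at hγ
    change I.symm (coord e (jet r γ) 0) ∈ e.target
    rw [coord_jet he hγ]
    simpa [Curve.derivs] using e.map_source hγ
  map_target' v hv := by
    change (curveOf (I := I) e he v).toFun 0 ∈ e.source
    rw [curveOf_zero]
    exact e.map_target hv
  left_inv' := by
    intro p
    refine Quotient.inductionOn p fun γ hγ => ?_
    change γ.toFun 0 ∈ e.source at hγ
    change jet r (curveOf e he (coord e (jet r γ))) = jet r γ
    rw [coord_jet he hγ]
    have h0 : I.symm (γ.derivs r e 0) = e (γ.toFun 0) := by simp [Curve.derivs]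
    have ht : I.symm (γ.derivs r e 0) ∈ e.target := by rw [h0]; exact e.map_source hγ
    have hb : (curveOf e he (γ.derivs r e)).toFun 0 = γ.toFun 0 := by
      rw [curveOf_zero, h0, e.left_inv hγ]
    exact (jet_eq_iff he (hb ▸ hγ)).2 ⟨hb, derivs_curveOf he ht⟩
  right_inv' v hv := by
    have hs : (curveOf (I := I) e he v).toFun 0 ∈ e.source := by
      rw [curveOf_zero]; exact e.map_target hv
    rw [coord_jet he hs, derivs_curveOf he hv]

lemma chart_trans_source (r : ℕ) {e e' : OpenPartialHomeomorph N H}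
    (he : e ∈ IsManifold.maximalAtlas I ∞ N) (he' : e' ∈ IsManifold.maximalAtlas I ∞ N) :
    ((chart r e he).symm.trans (chart r e' he')).source =
      {v : Fin (r + 1) → E | v 0 ∈ I.symm ⁻¹' (e.symm.trans e').source} := by
  ext v
  change (I.symm (v 0) ∈ e.target ∧ (curveOf (I := I) e he v).toFun 0 ∈ e'.source) ↔ _
  rw [curveOf_zero]
  simp

lemma contDiffOn_chart_trans (r : ℕ) {e e' : OpenPartialHomeomorph N H}
    (he : e ∈ IsManifold.maximalAtlas I ∞ N) (he' : e' ∈ IsManifold.maximalAtlas I ∞ N) :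
    ContDiffOn ℝ ∞ ((chart r e he).symm.trans (chart r e' he'))
      ((chart r e he).symm.trans (chart r e' he')).source := by
  rw [chart_trans_source]
  have hU : IsOpen (I.symm ⁻¹' (e.symm.trans e').source) :=
    (e.symm.trans e').open_source.preimage I.continuous_symm
  have hg : ContDiffOn ℝ ∞ (fun x => I (e' (e.symm (I.symm x))))
      (I.symm ⁻¹' (e.symm.trans e').source) := fun x hx => by
    obtain ⟨h1, h2⟩ : I.symm x ∈ e.target ∧ e.symm (I.symm x) ∈ e'.source := by simpa using hx
    exact (contDiffAt_transition he he' h1 h2).contDiffWithinAt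
  refine (contDiffOn_changeCoord r hU hg).congr fun v hv => ?_
  obtain ⟨h1, h2⟩ : I.symm (v 0) ∈ e.target ∧ e.symm (I.symm (v 0)) ∈ e'.source := by
    simpa using hv
  change coord e' (jet r (curveOf e he v)) = _
  have hs : (curveOf (I := I) e he v).toFun 0 ∈ e.source := by
    rw [curveOf_zero]; exact e.map_target h1
  have hs' : (curveOf (I := I) e he v).toFun 0 ∈ e'.source := by
    rw [curveOf_zero]; exact h2
  rw [coord_jet he' hs', Curve.derivs_change r _ he he' hs hs', derivs_curveOf he h1]

variable (I N) in
/-- The atlas of `T^r N` consisting of the charts induced by the charts of `N`. -/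
def core (r : ℕ) : ChartedSpaceCore (Fin (r + 1) → E) (HigherTangent I N r) where
  atlas := {c | ∃ e, ∃ he : e ∈ IsManifold.maximalAtlas I ∞ N, c = chart r e he}
  chartAt p := chart r (chartAt H p.base) (IsManifold.chart_mem_maximalAtlas p.base)
  mem_chart_source p := mem_chart_source H p.base
  chart_mem_atlas p := ⟨_, _, rfl⟩
  open_source := by
    rintro _ _ ⟨e, he, rfl⟩ ⟨e', he', rfl⟩
    rw [chart_trans_source]
    exact ((e.symm.trans e').open_source.preimage I.continuous_symm).preimage
      (continuous_apply (0 : Fin (r + 1)))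
  continuousOn_toFun := by
    rintro _ _ ⟨e, he, rfl⟩ ⟨e', he', rfl⟩
    exact (contDiffOn_chart_trans r he he').continuousOn

instance (r : ℕ) : TopologicalSpace (HigherTangent I N r) := (core I N r).toTopologicalSpace

instance (r : ℕ) : ChartedSpace (Fin (r + 1) → E) (HigherTangent I N r) :=
  (core I N r).toChartedSpace

instance (r : ℕ) : IsManifold 𝓘(ℝ, Fin (r + 1) → E) ∞ (HigherTangent I N r) := by
  refine isManifold_of_contDiffOn _ _ _ fun c c' hc hc' => ?_
  obtain ⟨_, ⟨e, he, rfl⟩, rfl⟩ : ∃ d, ∃ hd : d ∈ (core I N r).atlas,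
    c = (core I N r).openPartialHomeomorph d hd := by
    have h : c ∈ ⋃ (d) (hd : d ∈ (core I N r).atlas),
      {(core I N r).openPartialHomeomorph d hd} := hc
    simpa only [mem_iUnion, mem_singleton_iff] using h
  obtain ⟨_, ⟨e', he', rfl⟩, rfl⟩ : ∃ d, ∃ hd : d ∈ (core I N r).atlas,
    c' = (core I N r).openPartialHomeomorph d hd := by
    have h : c' ∈ ⋃ (d) (hd : d ∈ (core I N r).atlas),
      {(core I N r).openPartialHomeomorph d hd} := hc'
    simpa only [mem_iUnion, mem_singleton_iff] using h
  simpa using! contDiffOn_chart_trans r he he'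

end HigherTangent

end Charts

end Jets

/-! ### Smooth fibre bundles and affine bundles -/

section Bundles

variable {EP : Type*} [NormedAddCommGroup EP] [NormedSpace ℝ EP]
  {HP : Type*} [TopologicalSpace HP] (IP : ModelWithCorners ℝ EP HP)
  {P : Type*} [TopologicalSpace P] [ChartedSpace HP P]
  {EB : Type*} [NormedAddCommGroup EB] [NormedSpace ℝ EB]
  {HB : Type*} [TopologicalSpace HB] (IB : ModelWithCorners ℝ EB HB)
  {B : Type*} [TopologicalSpace B] [ChartedSpace HB B]

section FibreBundle

variable {EΦ : Type*} [NormedAddCommGroup EΦ] [NormedSpace ℝ EΦ]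
  {HΦ : Type*} [TopologicalSpace HΦ] (IΦ : ModelWithCorners ℝ EΦ HΦ)
  {Φ : Type*} [TopologicalSpace Φ] [ChartedSpace HΦ Φ]

/-- A local trivialization `p⁻¹(U) ≃ U × Φ` which is a diffeomorphism. -/
def IsSmoothTrivialization {p : P → B} (e : Trivialization Φ p) : Prop :=
  ContMDiffOn IP (IB.prod IΦ) ∞ e e.source ∧
    ContMDiffOn (IB.prod IΦ) IP ∞ e.toOpenPartialHomeomorph.symm e.target

variable (Φ) in
/-- `p : P → B` is a smooth fibre bundle with typical fibre the manifold `Φ`. -/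
structure IsSmoothFibreBundle (p : P → B) : Prop where
  contMDiff : ContMDiff IP IB ∞ p
  surjective : Function.Surjective p
  locally_trivial : ∀ b : B, ∃ e : Trivialization Φ p,
    b ∈ e.baseSet ∧ IsSmoothTrivialization IP IB IΦ e

end FibreBundle

/-- A bundle atlas making `p : P → B` an affine bundle with typical fibre the vector space `Φ`,
regarded as an affine space: the base sets of the smooth local trivializations cover `B`, and all
changes of trivialization are affine isomorphisms on the fibres. -/
structure IsAffineBundleAtlas {Φ : Type*} [NormedAddCommGroup Φ] [NormedSpace ℝ Φ] {p : P → B}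
    (A : Set (Trivialization Φ p)) : Prop where
  cover : ∀ b : B, ∃ e ∈ A, b ∈ e.baseSet
  smooth : ∀ e ∈ A, IsSmoothTrivialization IP IB 𝓘(ℝ, Φ) e
  affine_change : ∀ e ∈ A, ∀ e' ∈ A, ∀ b ∈ e.baseSet ∩ e'.baseSet, ∃ T : Φ ≃ᵃ[ℝ] Φ,
    ∀ v : Φ, e' (e.toOpenPartialHomeomorph.symm (b, v)) = (b, T v)

end Bundles

section FibrewiseAffine

variable {E : Type*} [NormedAddCommGroup E] [NormedSpace ℝ E]
  {H : Type*} [TopologicalSpace H] {I : ModelWithCorners ℝ E H}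
  {N : Type*} [TopologicalSpace N] [ChartedSpace H N]

/-- The fibres of `T^r N → T^{r-1} N` (`r ≥ 1`) are affine spaces: in the natural coordinates
induced by any chart of `N`, a fibre is parametrized by the derivative of order `r`, and the changes
of these coordinates are affine. A map from a vector space into a single fibre is affine
if it is affine in these coordinates. -/
def IsAffineIntoFibre {Φ : Type*} [AddCommGroup Φ] [Module ℝ Φ] {r : ℕ}
    (f : Φ → HigherTangent I N r) : Prop :=
  ∀ e ∈ IsManifold.maximalAtlas I ∞ N, (∀ v, (f v).base ∈ e.source) →
    ∃ T : Φ →ᵃ[ℝ] E, ∀ v, (f v).coord e (Fin.last r) = T v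

end FibrewiseAffine

end JetBundle

end

open JetBundle

noncomputable section

/-! ### Lie algebroids and jets of admissible curves -/

section LieAlgebroid

variable {EM : Type*} [NormedAddCommGroup EM] [NormedSpace ℝ EM]
  {H : Type*} [TopologicalSpace H] (I : ModelWithCorners ℝ EM H)
  {M : Type*} [TopologicalSpace M] [ChartedSpace H M] [IsManifold I ∞ M]
  (F : Type*) [NormedAddCommGroup F] [NormedSpace ℝ F]
  (V : M → Type*) [TopologicalSpace (TotalSpace F V)]
  [∀ x, AddCommGroup (V x)] [∀ x, Module ℝ (V x)] [∀ x, TopologicalSpace (V x)]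
  [FiberBundle F V] [VectorBundle ℝ F V]

/-- A Lie algebroid structure on the smooth vector bundle `E = TotalSpace F V` over `M`: an anchor
`ρ : E → TM`, which is a smooth vector bundle map over the identity, and a Lie algebra structure on
the space of smooth sections of `E` with `[σ, f η] = (ρ(σ) f) η + f [σ, η]`. -/
structure LieAlgebroid where
  anchor : ∀ x : M, V x →ₗ[ℝ] TangentSpace I x
  contMDiff_anchor : ContMDiff (I.prod 𝓘(ℝ, F)) I.tangent ∞
    fun a : TotalSpace F V => (⟨a.proj, anchor a.proj a.snd⟩ : TangentBundle I M)
  bracket : Cₛ^∞⟮I; F, V⟯ →ₗ[ℝ] Cₛ^∞⟮I; F, V⟯ →ₗ[ℝ] Cₛ^∞⟮I; F, V⟯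
  bracket_self : ∀ σ, bracket σ σ = 0
  jacobi : ∀ σ η ζ,
    bracket σ (bracket η ζ) + bracket η (bracket ζ σ) + bracket ζ (bracket σ η) = 0
  leibniz : ∀ (f : C^∞⟮I, M; 𝓘(ℝ, ℝ), ℝ⟯) (σ η fη : Cₛ^∞⟮I; F, V⟯), (∀ x, fη x = f x • η x) →
    ∀ x, bracket σ fη x =
      (show ℝ from mfderiv I 𝓘(ℝ, ℝ) f x (anchor x (σ x))) • η x + f x • bracket σ η x

namespace LieAlgebroid

variable {I F V} (L : LieAlgebroid I F V)

/-- A curve `a` in `E` is admissible if `ρ ∘ a` is the velocity of its base curve `γ = τ ∘ a`. -/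
def IsAdmissible (a : Curve (I.prod 𝓘(ℝ, F)) (TotalSpace F V)) : Prop :=
  ∀ᶠ t in 𝓝 (0 : ℝ), mfderiv 𝓘(ℝ, ℝ) I (fun s => (a.toFun s).proj) t (1 : ℝ) =
    L.anchor (a.toFun t).proj (a.toFun t).snd

/-- The set `E^k ⊆ T^{k-1} E` of `(k-1)`-jets of admissible curves; only `k ≥ 1` is meaningful. -/
def jets (k : ℕ) : Set (HigherTangent (I.prod 𝓘(ℝ, F)) (TotalSpace F V) (k - 1)) :=
  {p | ∃ a : Curve (I.prod 𝓘(ℝ, F)) (TotalSpace F V), L.IsAdmissible a ∧ jet (k - 1) a = p}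

/-- The projection `τ_{k,l} : E^k → E^l`, the restriction of `T^{k-1} E → T^{l-1} E`. -/
def jetsProj {k l : ℕ} (h : l ≤ k) : L.jets k → L.jets l :=
  MapsTo.restrict (HigherTangent.proj (Nat.sub_le_sub_right h 1)) (L.jets k) (L.jets l) <| by
    rintro _ ⟨a, ha, rfl⟩
    exact ⟨a, ha, rfl⟩

end LieAlgebroid

end LieAlgebroid

end

noncomputable section

/-! ### Derivatives of curves in vector spaces -/

section Analysis

variable {X : Type*} [NormedAddCommGroup X] [NormedSpace ℝ X]
  {Y : Type*} [NormedAddCommGroup Y] [NormedSpace ℝ Y]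

/-! In a bundle chart of `E` with base coordinates x and fibre coordinates y, admissibility of a
curve is the equation x' = ρ(x, y), with y unconstrained (`mfderiv_eq_anchor_iff`). Differentiating
it at 0 with Faà di Bruno expresses the derivative of x of order j + 1 through the derivatives of
(x, y) up to order j; this is `IsProlonged`. The field is written as the self-map `localField`, with
zero second component, only to fit `changeCoord`; nothing but its first component is read.

Conversely, every solution of these algebraic equations is the jet of an admissible curve
(`exists_isAdmissible`): choose a polynomial y with the prescribed derivatives and solve the
differential equation for x. Hence `mem_jets_iff`: in natural coordinates `E^k` is exactly the
solution set of the prolonged equations. That set is the image of the smooth section `prolong` of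
the linear projection `freeCoord` onto the initial value of x and the derivatives of y of orders 0,
…, k - 1. These are dim M + k · rank E free parameters, and an image of a smooth section is an
embedded submanifold (`SliceData.isSmoothEmbedding`).

In free coordinates `τ_{k,l}` forgets the derivatives of y of orders l, …, k - 1. These range over a
whole vector space, so they give a trivialization over the full domain of each bundle chart
(`exists_trivialization`).

For k = l + 1, only the derivative of order l varies along a fibre. Its x-part is constant there and
its y-part is the fibre coordinate, while a change of chart is affine in the derivative of highest
order (`exists_affine_changeCoord`). This gives both affine statements (`isAffineIntoFibre_trivInv`,
`exists_affineEquiv_trivFun_trivInv`). -/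

lemma iteratedDeriv_clm_comp (T : X →L[ℝ] Y) {f : ℝ → X} {t : ℝ} (hf : ContDiffAt ℝ ∞ f t)
    (i : ℕ) : iteratedDeriv i (fun s => T (f s)) t = T (iteratedDeriv i f t) := by
  have h := T.iteratedFDeriv_comp_left hf (i := i) (by exact_mod_cast le_top)
  simp only [iteratedDeriv]
  change iteratedFDeriv ℝ i (T ∘ f) t _ = _
  rw [h]
  rfl

lemma iteratedDeriv_comp_eq_changeCoord {r : ℕ} {g : X → X} {c : ℝ → X}
    (hg : ContDiffAt ℝ ∞ g (c 0)) (hc : ContDiffAt ℝ ∞ c 0) (i : Fin (r + 1)) :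
    iteratedDeriv i (fun t => g (c t)) 0 =
      changeCoord r g (fun j => iteratedDeriv j c 0) i := by
  change iteratedDeriv i (g ∘ c) 0 = _
  rw [iteratedDeriv_vcomp_eq_sum_orderedFinpartition hg hc (by exact_mod_cast le_top)]
  simp [changeCoord]

/-- A part with n elements exhausts the index set, whereas parts are nonempty and pairwise disjoint,
so no second part fits. -/
lemma OrderedFinpartition.eq_of_partSize_eq {n : ℕ} (c : OrderedFinpartition n)
    {i j : Fin c.length} (hi : c.partSize i = n) : i = j := by
  by_contra hij
  have h0 : 0 < c.partSize j := c.partSize_pos j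
  have hinj : Function.Injective (c.emb i) := (c.emb_strictMono i).injective
  have hsurj : Function.Surjective (c.emb i) :=
    ((Fintype.bijective_iff_injective_and_card (c.emb i)).2 ⟨hinj, by simp [hi]⟩).2
  obtain ⟨a, ha⟩ := hsurj (c.emb j ⟨0, h0⟩)
  exact c.emb_ne_emb_of_ne hij ha

/-- The derivative of highest order enters affinely into the change of coordinates on jets. -/
lemma exists_affine_changeCoord {r : ℕ} (g : X → X) (hr : 0 < r) (u : Fin (r + 1) → X) :
    ∃ T : X →ᵃ[ℝ] X, ∀ v : Fin (r + 1) → X, (∀ i, i ≠ Fin.last r → v i = u i) →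
      changeCoord r g v (Fin.last r) = T (v (Fin.last r)) := by
  have key : ∀ c : OrderedFinpartition r, ∃ T : X →ᵃ[ℝ] X, ∀ v : Fin (r + 1) → X,
      (∀ i, i ≠ Fin.last r → v i = u i) →
      (iteratedFDeriv ℝ c.length g (v 0) fun j =>
        v ⟨c.partSize j, Nat.lt_succ_of_le (c.partSize_le j)⟩) = T (v (Fin.last r)) := by
    intro c
    -- Positivity of r enters here: the base point `v 0` is then of lower order, so the multilinear
    -- coefficients are fixed by `u`.
    have h0 : (0 : Fin (r + 1)) ≠ Fin.last r := by
      intro h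
      exact hr.ne (congrArg Fin.val h)
    -- A partition with a part of size r has no other part, and its term is linear in the top
    -- derivative. Every other partition involves only lower derivatives and contributes a constant.
    by_cases hc : ∃ j, c.partSize j = r
    · obtain ⟨j, hj⟩ := hc
      refine ⟨((iteratedFDeriv ℝ c.length g (u 0)).toMultilinearMap.toLinearMap 0 j).toAffineMap,
        fun v hv => ?_⟩
      rw [hv 0 h0]
      change _ = iteratedFDeriv ℝ c.length g (u 0) (Function.update 0 j (v (Fin.last r)))
      congr 1
      funext i
      have hji : j = i := c.eq_of_partSize_eq hj
      subst hji
      rw [Function.update_self]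
      congr 1
      exact Fin.ext hj
    · push Not at hc
      refine ⟨AffineMap.const ℝ X (iteratedFDeriv ℝ c.length g (u 0) fun j =>
        u ⟨c.partSize j, Nat.lt_succ_of_le (c.partSize_le j)⟩), fun v hv => ?_⟩
      rw [hv 0 h0, AffineMap.const_apply]
      congr 1
      funext i
      exact hv _ fun h => hc i (congrArg Fin.val h)
  choose T hT using key
  refine ⟨∑ c, T c, fun v hv => ?_⟩
  have hsum : ∀ (s : Finset (OrderedFinpartition r)) (x : X),
      (∑ c ∈ s, T c) x = ∑ c ∈ s, T c x := by
    classical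
    intro s x
    induction s using Finset.induction_on with
    | empty => simp
    | insert a s ha ih => rw [Finset.sum_insert ha, Finset.sum_insert ha, ← ih]; rfl
  rw [hsum]
  exact Finset.sum_congr rfl fun c _ => hT c v hv

/-- Local solutions of smooth ordinary differential equations with a smooth parameter curve. -/
lemma exists_smooth_solution [CompleteSpace X] {B : X × Y → X} {Ω : Set (X × Y)} (hΩ : IsOpen Ω)
    (hB : ContDiffOn ℝ ∞ B Ω) {y : ℝ → Y} (hy : ContDiff ℝ ∞ y) {x₀ : X} (h0 : (x₀, y 0) ∈ Ω) :
    ∃ x : ℝ → X, x 0 = x₀ ∧ ∀ᶠ t in 𝓝 (0 : ℝ),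
      (x t, y t) ∈ Ω ∧ HasDerivAt x (B (x t, y t)) t ∧ ContDiffAt ℝ ∞ x t := by
  -- Time is adjoined as a coordinate with derivative 1, which makes the equation autonomous.
  set f : X × ℝ → X × ℝ := fun z => (B (z.1, y z.2), 1) with hf
  set U : Set (X × ℝ) := (fun z : X × ℝ => (z.1, y z.2)) ⁻¹' Ω with hU
  have hyc : ContDiff ℝ ∞ fun z : X × ℝ => (z.1, y z.2) :=
    contDiff_fst.prodMk (hy.comp contDiff_snd)
  have hUo : IsOpen U := hΩ.preimage hyc.continuous
  have hfU : ContDiffOn ℝ ∞ f U :=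
    (hB.comp hyc.contDiffOn (fun _ h => h)).prodMk contDiffOn_const
  have h0U : ((x₀, (0 : ℝ)) : X × ℝ) ∈ U := h0
  have hf0 : ContDiffAt ℝ 1 f (x₀, 0) :=
    (hfU.contDiffAt (hUo.mem_nhds h0U)).of_le (by exact_mod_cast le_top)
  obtain ⟨z, hz0, ε, hε, hz⟩ :=
    hf0.exists_forall_mem_closedBall_exists_eq_forall_mem_Ioo_hasDerivAt₀ 0
  simp only [zero_sub, zero_add] at hz
  have hzc : ContinuousAt z 0 := (hz 0 ⟨by linarith, hε⟩).continuousAt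
  have hev : ∀ᶠ t in 𝓝 (0 : ℝ), z t ∈ U :=
    hzc.eventually (hUo.mem_nhds (by rw [hz0]; exact h0U))
  obtain ⟨δ, hδ, hδU⟩ := Metric.eventually_nhds_iff_ball.1 hev
  -- On the closed interval of radius η the solution exists and stays in `U`, where the field is
  -- smooth; regularity of the solution then bootstraps to all orders.
  set η := min ε δ / 2 with hη
  have hηpos : 0 < η := by positivity
  have hηε : η < ε := by have := min_le_left ε δ; have := lt_min hε hδ; linarith
  have hηδ : η < δ := by have := min_le_right ε δ; have := lt_min hε hδ; linarith
  have hsub : Icc (-η) η ⊆ Ioo (-ε) ε := fun t ht => ⟨by linarith [ht.1], by linarith [ht.2]⟩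
  have hmem : MapsTo z (Icc (-η) η) U := fun t ht => hδU t (by
    rw [Metric.mem_ball, Real.dist_eq, sub_zero]
    exact lt_of_le_of_lt (abs_le.2 ht) hηδ)
  have hsm : ContDiffOn ℝ ∞ z (Icc (-η) η) := by
    refine ODE.contDiffOn_enat_Icc_of_hasDerivWithinAt (f := fun _ => f) (u := U) (n := ⊤) ?_
      (fun t ht => (hz t (hsub ht)).hasDerivWithinAt) hmem
    exact hfU.comp contDiffOn_snd (fun p hp => hp.2)
  -- The adjoined coordinate is time itself: its difference from t has zero derivative and vanishes
  -- at 0.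
  have hz2 : ∀ t ∈ Ioo (-ε) ε, (z t).2 = t := by
    have hd : ∀ t ∈ Ioo (-ε) ε, HasDerivAt (fun t => (z t).2 - t) 0 t := fun t ht => by
      have h1 : HasDerivAt (fun t => (z t).2) (1 : ℝ) t := (hz t ht).snd
      rw [← sub_self (1 : ℝ)]
      exact h1.sub (hasDerivAt_id t)
    intro t ht
    have h := (convex_Ioo (-ε) ε).is_const_of_fderivWithin_eq_zero (𝕜 := ℝ)
      (f := fun t => (z t).2 - t)
      (fun s hs => (hd s hs).differentiableAt.differentiableWithinAt)
      (fun s hs => by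
        rw [fderivWithin_of_isOpen isOpen_Ioo hs]
        ext
        simpa using (hd s hs).deriv) ht (show (0 : ℝ) ∈ Ioo (-ε) ε from ⟨by linarith, hε⟩)
    simp only [hz0, sub_zero] at h
    linarith
  refine ⟨fun t => (z t).1, by simp [hz0], ?_⟩
  filter_upwards [Ioo_mem_nhds (show -η < 0 by linarith) hηpos] with t ht
  have ht' : t ∈ Icc (-η) η := ⟨ht.1.le, ht.2.le⟩
  have e2 := hz2 t (hsub ht')
  refine ⟨?_, ?_, ?_⟩
  · have := hmem ht'
    simp only [hU, mem_preimage, e2] at this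
    exact this
  · have h1 : HasDerivAt (fun t => (z t).1) (B ((z t).1, y (z t).2)) t := (hz t (hsub ht')).fst
    rwa [e2] at h1
  · exact contDiffAt_fst.comp t (hsm.contDiffAt (Icc_mem_nhds ht.1 ht.2))

end Analysis

/-! ### Prolongation of a first order equation to jets -/

section Prolongation

variable {X : Type*} [NormedAddCommGroup X] [NormedSpace ℝ X]
  {Y : Type*} [NormedAddCommGroup Y] [NormedSpace ℝ Y]

/-- The equations on jets of order `r` of curves `(x, y)` which are consequences of
`x' = (g (x, y)).1`. -/
def IsProlonged {r : ℕ} (g : X × Y → X × Y) (v : Fin (r + 1) → X × Y) : Prop :=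
  ∀ j : Fin r, (v j.succ).1 = (changeCoord r g v j.castSucc).1

/-- The solution of the equations `IsProlonged g v` with prescribed free coordinates. -/
def prolong (g : X × Y → X × Y) : (r : ℕ) → X × (Fin (r + 1) → Y) → Fin (r + 1) → X × Y
  | 0, w => fun _ => (w.1, w.2 0)
  | r + 1, w => Fin.snoc (α := fun _ => X × Y) (prolong g r (w.1, Fin.init w.2))
      ((changeCoord r g (prolong g r (w.1, Fin.init w.2)) (Fin.last r)).1, w.2 (Fin.last (r + 1)))

variable (X Y) in
/-- The initial value of `x` and all derivatives of `y`. -/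
def freeCoord (r : ℕ) : (Fin (r + 1) → X × Y) →L[ℝ] X × (Fin (r + 1) → Y) :=
  ((ContinuousLinearMap.fst ℝ X Y).comp (ContinuousLinearMap.proj 0)).prod
    (ContinuousLinearMap.pi fun i =>
      (ContinuousLinearMap.snd ℝ X Y).comp (ContinuousLinearMap.proj i))

@[simp] lemma freeCoord_apply {r : ℕ} (v : Fin (r + 1) → X × Y) :
    freeCoord X Y r v = ((v 0).1, fun i => (v i).2) := rfl

/-- The equation with index j involves only derivatives of order at most j + 1, so the truncated
equations are literally among the original ones. -/
lemma IsProlonged.restrict {r s : ℕ} (h : s ≤ r) {g : X × Y → X × Y} {v : Fin (r + 1) → X × Y}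
    (hv : IsProlonged g v) :
    IsProlonged g fun i : Fin (s + 1) => v (Fin.castLE (Nat.succ_le_succ h) i) :=
  fun j => hv (Fin.castLE h j)

lemma isProlonged_succ_iff {r : ℕ} {g : X × Y → X × Y} {v : Fin (r + 2) → X × Y} :
    IsProlonged g v ↔ IsProlonged g (Fin.init v : Fin (r + 1) → X × Y) ∧
      (v (Fin.last (r + 1))).1 =
        (changeCoord r g (Fin.init v : Fin (r + 1) → X × Y) (Fin.last r)).1 := by
  constructor
  · intro h
    exact ⟨fun j => h j.castSucc, h (Fin.last r)⟩
  · rintro ⟨h1, h2⟩ j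
    refine Fin.lastCases ?_ (fun i => ?_) j
    · exact h2
    · exact h1 i

lemma freeCoord_prolong (g : X × Y → X × Y) (r : ℕ) (w : X × (Fin (r + 1) → Y)) :
    freeCoord X Y r (prolong g r w) = w := by
  induction r with
  | zero =>
    refine Prod.ext rfl (funext fun i => ?_)
    rw [Subsingleton.elim (α := Fin 1) i 0]
    rfl
  | succ r ih =>
    have h := ih (w.1, Fin.init w.2)
    simp only [freeCoord_apply, Prod.ext_iff] at h
    refine Prod.ext ?_ (funext fun i => ?_)
    · exact h.1
    · refine Fin.lastCases ?_ (fun i => ?_) i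
      · simp [prolong]
      · simpa [prolong, Fin.init] using congrFun h.2 i

lemma prolong_zero_apply (g : X × Y → X × Y) (r : ℕ) (w : X × (Fin (r + 1) → Y)) :
    prolong g r w 0 = (w.1, w.2 0) := by
  have h := freeCoord_prolong g r w
  simp only [freeCoord_apply, Prod.ext_iff] at h
  exact Prod.ext h.1 (congrFun h.2 0)

lemma isProlonged_prolong (g : X × Y → X × Y) (r : ℕ) (w : X × (Fin (r + 1) → Y)) :
    IsProlonged g (prolong g r w) := by
  induction r with
  | zero => exact fun j => j.elim0
  | succ r ih =>
    rw [isProlonged_succ_iff]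
    simp only [prolong, Fin.init_snoc, Fin.snoc_last]
    exact ⟨ih _, trivial⟩

/-- Uniqueness, by recursion on the order. With `freeCoord_prolong` and `isProlonged_prolong` it
makes `freeCoord` and `prolong` inverse bijections between solutions and free coordinates. Later,
jets are compared by comparing free coordinates alone. -/
lemma IsProlonged.eq_prolong {g : X × Y → X × Y} {r : ℕ} {v : Fin (r + 1) → X × Y}
    (hv : IsProlonged g v) : prolong g r (freeCoord X Y r v) = v := by
  induction r with
  | zero =>
    funext i
    rw [Subsingleton.elim (α := Fin 1) i 0]
    rfl
  | succ r ih =>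
    rw [isProlonged_succ_iff] at hv
    have h : prolong g r ((v 0).1, Fin.init fun i => (v i).2) = Fin.init v := ih hv.1
    rw [freeCoord_apply, prolong, h, ← hv.2]
    exact Fin.snoc_init_self v

lemma contDiffOn_prolong {g : X × Y → X × Y} {U : Set (X × Y)} (hU : IsOpen U)
    (hg : ContDiffOn ℝ ∞ g U) (r : ℕ) :
    ContDiffOn ℝ ∞ (prolong g r) {w | (w.1, w.2 0) ∈ U} := by
  induction r with
  | zero =>
    refine ContDiff.contDiffOn ?_
    change ContDiff ℝ ∞ fun (w : X × (Fin (0 + 1) → Y)) (_ : Fin (0 + 1)) => (w.1, w.2 0)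
    fun_prop
  | succ r ih =>
    have h1 : ContDiffOn ℝ ∞ (fun w : X × (Fin (r + 2) → Y) => prolong g r (w.1, Fin.init w.2))
        {w | (w.1, w.2 0) ∈ U} := by
      refine ih.comp (ContDiff.contDiffOn ?_) (fun w hw => hw)
      unfold Fin.init
      fun_prop
    rw [contDiffOn_pi]
    intro i
    refine Fin.lastCases ?_ (fun i => ?_) i
    · simp only [prolong, Fin.snoc_last]
      refine ContDiffOn.prodMk ?_ (ContDiff.contDiffOn (by fun_prop))
      have h2 := (contDiffOn_changeCoord r hU hg).comp h1 (fun w hw => by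
        rw [mem_ofPred_eq, prolong_zero_apply]; exact hw)
      exact contDiff_fst.comp_contDiffOn ((contDiffOn_pi.1 h2) (Fin.last r))
    · simp only [prolong, Fin.snoc_castSucc]
      exact (contDiffOn_pi.1 h1) i

/-- The jets of solutions of `x' = (g (x, y)).1` satisfy the prolonged equations. -/
lemma isProlonged_of_hasDerivAt {g : X × Y → X × Y} {c : ℝ → X × Y} (r : ℕ)
    (hg : ContDiffAt ℝ ∞ g (c 0)) (hc : ContDiffAt ℝ ∞ c 0)
    (hd : ∀ᶠ t in 𝓝 (0 : ℝ), HasDerivAt (fun s => (c s).1) (g (c t)).1 t) :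
    IsProlonged g fun j : Fin (r + 1) => iteratedDeriv j c 0 := by
  intro j
  have h1 := iteratedDeriv_clm_comp (ContinuousLinearMap.fst ℝ X Y) hc (j + 1)
  have h2 := iteratedDeriv_clm_comp (ContinuousLinearMap.fst ℝ X Y) (hg.comp 0 hc) j
  have h3 := iteratedDeriv_comp_eq_changeCoord (r := r) hg hc j.castSucc
  simp only [ContinuousLinearMap.coe_fst', Function.comp_apply] at h1 h2
  change iteratedDeriv j (g ∘ c) 0 = _ at h3
  rw [h3] at h2
  change (iteratedDeriv ((j : ℕ) + 1) c 0).1 = _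
  rw [← h1, ← h2, iteratedDeriv_succ']
  -- The equation holds near 0, not only at 0, and may therefore be differentiated j times there.
  have hev : deriv (fun s => (c s).1) =ᶠ[𝓝 0] fun t => (g (c t)).1 := by
    filter_upwards [hd] with t ht using ht.deriv
  exact hev.iteratedDeriv_eq _

end Prolongation

/-! ### Embedded submanifolds given by local sections of a linear projection -/

section Slices

variable {E' : Type*} [NormedAddCommGroup E'] [NormedSpace ℝ E']
  {N : Type*} [TopologicalSpace N] [ChartedSpace E' N]
  {W : Type*} [NormedAddCommGroup W] [NormedSpace ℝ W]

/-- Around each of its points, the subset `S` of the manifold `N` is in a chart of `N` the image of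
a smooth section of the linear projection `proj`, which is defined on an open set. -/
structure SliceData (S : Set N) (W : Type*) [NormedAddCommGroup W] [NormedSpace ℝ W] where
  proj : E' →L[ℝ] W
  lift : W →L[ℝ] E'
  proj_lift : Function.RightInverse lift proj
  chart : S → OpenPartialHomeomorph N E'
  chart_mem : ∀ i, chart i ∈ IsManifold.maximalAtlas 𝓘(ℝ, E') ∞ N
  mem_source : ∀ p : S, p.1 ∈ (chart p).source
  dom : S → Set W
  isOpen_dom : ∀ i, IsOpen (dom i)
  sec : S → W → E'
  contDiffOn_sec : ∀ i, ContDiffOn ℝ ∞ (sec i) (dom i)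
  proj_sec : ∀ i, ∀ w ∈ dom i, proj (sec i w) = w
  sec_mem : ∀ i, ∀ w ∈ dom i, sec i w ∈ (chart i).target
  symm_sec_mem : ∀ i, ∀ w ∈ dom i, (chart i).symm (sec i w) ∈ S
  proj_mem : ∀ i, ∀ p ∈ S, p ∈ (chart i).source → proj (chart i p) ∈ dom i
  sec_proj : ∀ i, ∀ p ∈ S, p ∈ (chart i).source → sec i (proj (chart i p)) = chart i p

namespace SliceData

variable {S : Set N} (D : SliceData (E' := E') S W)

open Classical in
/-- The chart of `S` obtained by projecting a chart of `N`. -/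
def sliceChart (i : S) : OpenPartialHomeomorph S W where
  toFun p := D.proj (D.chart i p.1)
  -- Off the domain of the section the value is irrelevant; `i` is simply an available point of `S`.
  invFun w := if h : w ∈ D.dom i then ⟨(D.chart i).symm (D.sec i w), D.symm_sec_mem i w h⟩ else i
  source := {p | p.1 ∈ (D.chart i).source}
  target := D.dom i
  map_source' p hp := D.proj_mem i p p.2 hp
  map_target' w hw := by
    simp only [dif_pos hw]
    exact (D.chart i).map_target (D.sec_mem i w hw)
  left_inv' p hp := by
    simp only [dif_pos (D.proj_mem i p p.2 hp)]
    refine Subtype.ext ?_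
    simp only [D.sec_proj i p p.2 hp]
    exact (D.chart i).left_inv hp
  right_inv' w hw := by
    simp only [dif_pos hw]
    rw [(D.chart i).right_inv (D.sec_mem i w hw), D.proj_sec i w hw]
  open_source := (D.chart i).open_source.preimage continuous_subtype_val
  open_target := D.isOpen_dom i
  continuousOn_toFun := D.proj.continuous.comp_continuousOn
    ((D.chart i).continuousOn.comp continuous_subtype_val.continuousOn fun _ h => h)
  continuousOn_invFun := by
    rw [Topology.IsInducing.subtypeVal.continuousOn_iff]
    refine ((D.chart i).continuousOn_symm.comp (D.contDiffOn_sec i).continuousOn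
      (D.sec_mem i)).congr fun w hw => ?_
    simp [dif_pos hw]

lemma sliceChart_apply (i p : S) : D.sliceChart i p = D.proj (D.chart i p.1) := rfl

lemma coe_sliceChart_symm_apply (i : S) {w : W} (hw : w ∈ D.dom i) :
    ((D.sliceChart i).symm w : N) = (D.chart i).symm (D.sec i w) := by
  simp [sliceChart, hw]

/-- The charted space structure on `S`. -/
abbrev chartedSpace : ChartedSpace W S where
  atlas := range D.sliceChart
  chartAt := D.sliceChart
  mem_chart_source := D.mem_source
  chart_mem_atlas := mem_range_self

/-- A transition map is a section, followed by a change of charts of `N`, followed by the linear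
projection; each factor is smooth. -/
lemma isManifold [IsManifold 𝓘(ℝ, E') ∞ N] :
    letI := D.chartedSpace
    IsManifold 𝓘(ℝ, W) ∞ S := by
  let := D.chartedSpace
  refine isManifold_of_contDiffOn _ _ _ ?_
  rintro _ _ ⟨i, rfl⟩ ⟨j, rfl⟩
  have h1 : ContMDiffOn 𝓘(ℝ, W) 𝓘(ℝ, E') ∞
      (fun w => D.chart j ((D.chart i).symm (D.sec i w)))
      ((D.sliceChart i).symm.trans (D.sliceChart j)).source := by
    intro w hw
    have hw1 : w ∈ D.dom i := hw.1
    have hw2 : (D.chart i).symm (D.sec i w) ∈ (D.chart j).source := by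
      rw [← D.coe_sliceChart_symm_apply i hw1]
      exact hw.2
    refine ContMDiffAt.contMDiffWithinAt ?_
    have e1 : ContMDiffAt 𝓘(ℝ, W) 𝓘(ℝ, E') ∞ (D.sec i) w :=
      ((D.contDiffOn_sec i).contDiffAt ((D.isOpen_dom i).mem_nhds hw1)).contMDiffAt
    exact (contMDiffAt_of_mem_maximalAtlas (D.chart_mem j) hw2).comp w
      ((contMDiffAt_symm_of_mem_maximalAtlas (D.chart_mem i) (D.sec_mem i w hw1)).comp w e1)
  have h2 := D.proj.contDiff.comp_contDiffOn (n := ∞) (contMDiffOn_iff_contDiffOn.1 h1)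
  simp only [modelWithCornersSelf_coe, modelWithCornersSelf_coe_symm, range_id, inter_univ,
    preimage_id, Function.comp_id, Function.id_comp]
  refine h2.congr fun w hw => ?_
  have hw1 : w ∈ D.dom i := hw.1
  simp [sliceChart_apply, D.coe_sliceChart_symm_apply i hw1]

/-- The local diffeomorphism of the model space which maps the image of the section to a linear
subspace. -/
def shear (i : S) : OpenPartialHomeomorph E' E' where
  toFun v := v - D.sec i (D.proj v) + D.lift (D.proj v)
  invFun v := v + D.sec i (D.proj v) - D.lift (D.proj v)
  source := D.proj ⁻¹' D.dom i
  target := D.proj ⁻¹' D.dom i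
  -- Both `sec` and `lift` are right inverse to `proj`, so the shear preserves `proj v`. Hence
  -- source and target coincide, and the inverse only reverses the signs.
  map_source' v hv := by
    simpa [D.proj_sec i _ hv, D.proj_lift (D.proj v)] using hv
  map_target' v hv := by
    simpa [D.proj_sec i _ hv, D.proj_lift (D.proj v)] using hv
  left_inv' v hv := by
    simp [D.proj_sec i _ hv, D.proj_lift (D.proj v)]
    abel
  right_inv' v hv := by
    simp [D.proj_sec i _ hv, D.proj_lift (D.proj v)]
    abel
  open_source := (D.isOpen_dom i).preimage D.proj.continuous
  open_target := (D.isOpen_dom i).preimage D.proj.continuous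
  continuousOn_toFun := (continuousOn_id.sub ((D.contDiffOn_sec i).continuousOn.comp
    D.proj.continuous.continuousOn fun _ h => h)).add (by fun_prop)
  continuousOn_invFun := (continuousOn_id.add ((D.contDiffOn_sec i).continuousOn.comp
    D.proj.continuous.continuousOn fun _ h => h)).sub (by fun_prop)

lemma contDiffOn_shear (i : S) : ContDiffOn ℝ ∞ (D.shear i) (D.shear i).source :=
  (contDiffOn_id.sub ((D.contDiffOn_sec i).comp D.proj.contDiff.contDiffOn fun _ h => h)).add
    (D.lift.contDiff.comp D.proj.contDiff).contDiffOn

lemma contDiffOn_shear_symm (i : S) : ContDiffOn ℝ ∞ (D.shear i).symm (D.shear i).target :=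
  (contDiffOn_id.add ((D.contDiffOn_sec i).comp D.proj.contDiff.contDiffOn fun _ h => h)).sub
    (D.lift.contDiff.comp D.proj.contDiff).contDiffOn

lemma trans_shear_mem_maximalAtlas [IsManifold 𝓘(ℝ, E') ∞ N] (i : S) :
    (D.chart i).trans (D.shear i) ∈ IsManifold.maximalAtlas 𝓘(ℝ, E') ∞ N := by
  refine OpenPartialHomeomorph.mem_maximalAtlas_of_contMDiffOn (I := 𝓘(ℝ, E')) (n := ∞) _ ?_ ?_
  · rw [OpenPartialHomeomorph.trans_source]
    exact (D.contDiffOn_shear i).contMDiffOn.comp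
      ((contMDiffOn_of_mem_maximalAtlas (D.chart_mem i)).mono inter_subset_left) fun _ h => h.2
  · rw [OpenPartialHomeomorph.trans_target]
    exact (contMDiffOn_symm_of_mem_maximalAtlas (D.chart_mem i)).comp
      ((D.contDiffOn_shear_symm i).contMDiffOn.mono inter_subset_left) fun _ h => h.2

/-- After the shear the section becomes the linear map `lift`. Under the splitting of `E'` as `W`
times the kernel of `proj`, the inclusion then reads w ↦ (w, 0), the normal form of an immersion. -/
lemma isSmoothEmbedding [IsManifold 𝓘(ℝ, E') ∞ N] :
    letI := D.chartedSpace
    Manifold.IsSmoothEmbedding 𝓘(ℝ, W) 𝓘(ℝ, E') ∞ (Subtype.val : S → N) := by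
  let := D.chartedSpace
  have := D.isManifold
  refine ⟨?_, IsEmbedding.subtypeVal⟩
  refine Manifold.IsImmersionOfComplement.isImmersion (F := D.proj.ker) fun p => ?_
  refine Manifold.IsImmersionAtOfComplement.mk_of_charts
    (ContinuousLinearEquiv.equivOfRightInverse D.proj D.lift D.proj_lift).symm
    (D.sliceChart p) ((D.chart p).trans (D.shear p)) (D.mem_source p)
    ⟨D.mem_source p, D.proj_mem p p p.2 (D.mem_source p)⟩
    (IsManifold.chart_mem_maximalAtlas (H := W) p) (D.trans_shear_mem_maximalAtlas p)
    (fun q hq => ⟨hq, D.proj_mem p q q.2 hq⟩) ?_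
  intro w hw
  have hw1 : w ∈ D.dom p := by
    have : w ∈ (D.sliceChart p).target := by simpa using hw
    exact this
  have h1 : ((D.sliceChart p).symm w : N) = _ := D.coe_sliceChart_symm_apply p hw1
  change D.shear p (D.chart p ((D.sliceChart p).symm w : S).1) = _
  rw [h1, (D.chart p).right_inv (D.sec_mem p w hw1)]
  change D.sec p w - D.sec p (D.proj (D.sec p w)) + D.lift (D.proj (D.sec p w)) = _
  rw [D.proj_sec p w hw1]
  simp

end SliceData

/-- Smoothness of maps into an embedded submanifold. -/
lemma Manifold.IsSmoothEmbedding.contMDiffAt_iff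
    {E₁ : Type*} [NormedAddCommGroup E₁] [NormedSpace ℝ E₁] {H₁ : Type*} [TopologicalSpace H₁]
    {I₁ : ModelWithCorners ℝ E₁ H₁} {M₁ : Type*} [TopologicalSpace M₁] [ChartedSpace H₁ M₁]
    {E₂ : Type*} [NormedAddCommGroup E₂] [NormedSpace ℝ E₂] {H₂ : Type*} [TopologicalSpace H₂]
    {I₂ : ModelWithCorners ℝ E₂ H₂} {M₂ : Type*} [TopologicalSpace M₂] [ChartedSpace H₂ M₂]
    {E₃ : Type*} [NormedAddCommGroup E₃] [NormedSpace ℝ E₃] {H₃ : Type*} [TopologicalSpace H₃]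
    {I₃ : ModelWithCorners ℝ E₃ H₃} {M₃ : Type*} [TopologicalSpace M₃] [ChartedSpace H₃ M₃]
    [IsManifold I₁ ∞ M₁] [IsManifold I₂ ∞ M₂] [IsManifold I₃ ∞ M₃]
    {φ : M₂ → M₃} (hφ : Manifold.IsSmoothEmbedding I₂ I₃ ∞ φ) {f : M₁ → M₂} {x : M₁} :
    ContMDiffAt I₁ I₂ ∞ f x ↔ ContMDiffAt I₁ I₃ ∞ (fun y => φ (f y)) x := by
  obtain ⟨F, _, _, h⟩ := hφ.isImmersion
  rw [ContMDiffAt.iff_comp_isImmersionAtOfComplement (h (f x))]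
  exact ⟨fun k => k.2, fun k => ⟨hφ.isEmbedding.isInducing.continuousAt_iff.2 k.continuousAt, k⟩⟩

end Slices

/-! ### Lie algebroids in bundle charts -/

section BundleCharts

variable {EM : Type*} [NormedAddCommGroup EM] [NormedSpace ℝ EM]
  {H : Type*} [TopologicalSpace H] {I : ModelWithCorners ℝ EM H}
  {M : Type*} [TopologicalSpace M] [ChartedSpace H M]
  {F : Type*} [NormedAddCommGroup F]
  {V : M → Type*} [TopologicalSpace (TotalSpace F V)]
  [∀ x, AddCommGroup (V x)] [∀ x, TopologicalSpace (V x)] [FiberBundle F V]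

variable (F V) in
/-- The chart of the total space of a vector bundle induced by the preferred chart and the preferred
trivialization at a point of the base. -/
def bundleChart (p : M) : OpenPartialHomeomorph (TotalSpace F V) (ModelProd H F) :=
  chartAt (ModelProd H F) (⟨p, 0⟩ : TotalSpace F V)

lemma mem_bundleChart_source_iff {p : M} {a : TotalSpace F V} :
    a ∈ (bundleChart (H := H) F V p).source ↔
      a.proj ∈ (trivializationAt F V p).baseSet ∩ (chartAt H p).source := by
  rw [bundleChart, FiberBundle.chartedSpace_chartAt, OpenPartialHomeomorph.trans_source, mem_inter_iff,
    (trivializationAt F V p).mem_source, mem_inter_iff]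
  refine and_congr_right fun h => ?_
  rw [mem_preimage, OpenPartialHomeomorph.prod_source, mem_prod]
  change (trivializationAt F V p a).1 ∈ _ ∧ _ ↔ _
  rw [(trivializationAt F V p).coe_fst' h]
  simp

lemma mem_bundleChart_source (a : TotalSpace F V) :
    a ∈ (bundleChart (H := H) F V a.proj).source :=
  mem_bundleChart_source_iff.2 ⟨mem_baseSet_trivializationAt F V a.proj, mem_chart_source H a.proj⟩

variable [NormedSpace ℝ F]

lemma bundleChart_mem_maximalAtlas [IsManifold (I.prod 𝓘(ℝ, F)) ∞ (TotalSpace F V)] (p : M) :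
    bundleChart F V p ∈ IsManifold.maximalAtlas (I.prod 𝓘(ℝ, F)) ∞ (TotalSpace F V) :=
  IsManifold.chart_mem_maximalAtlas _

lemma bundleChart_fst {p : M} {a : TotalSpace F V} (ha : a ∈ (bundleChart (H := H) F V p).source) :
    ((I.prod 𝓘(ℝ, F)) (bundleChart F V p a)).1 = extChartAt I p a.proj := by
  have h := (mem_bundleChart_source_iff.1 ha).1
  rw [bundleChart, FiberBundle.chartedSpace_chartAt]
  change I (chartAt H p (trivializationAt F V p a).1) = I (chartAt H p a.proj)
  rw [(trivializationAt F V p).coe_fst' h]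

variable (I F V) in
/-- The domain of the coordinates of the bundle chart at `p`. -/
def coordDomain (p : M) : Set (EM × F) :=
  (I.prod 𝓘(ℝ, F)).symm ⁻¹' (bundleChart F V p).target

lemma isOpen_coordDomain (p : M) : IsOpen (coordDomain I F V p) :=
  (bundleChart F V p).open_target.preimage (I.prod 𝓘(ℝ, F)).continuous_symm

lemma mem_coordDomain {p : M} {a : TotalSpace F V} (ha : a ∈ (bundleChart (H := H) F V p).source) :
    (I.prod 𝓘(ℝ, F)) (bundleChart F V p a) ∈ coordDomain I F V p := by
  rw [coordDomain, mem_preimage, ModelWithCorners.left_inv]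
  exact (bundleChart F V p).map_source ha

end BundleCharts

namespace LieAlgebroid

variable {EM : Type*} [NormedAddCommGroup EM] [NormedSpace ℝ EM]
  {H : Type*} [TopologicalSpace H] {I : ModelWithCorners ℝ EM H}
  {M : Type*} [TopologicalSpace M] [ChartedSpace H M] [IsManifold I ∞ M]
  {F : Type*} [NormedAddCommGroup F] [NormedSpace ℝ F]
  {V : M → Type*} [TopologicalSpace (TotalSpace F V)]
  [∀ x, AddCommGroup (V x)] [∀ x, Module ℝ (V x)] [∀ x, TopologicalSpace (V x)]
  [FiberBundle F V] [VectorBundle ℝ F V]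
  (L : LieAlgebroid I F V)

/-- The anchor as a map into the tangent bundle. -/
def anchorMap (a : TotalSpace F V) : TangentBundle I M := ⟨a.proj, L.anchor a.proj a.snd⟩

/-- The anchor in the coordinates of the bundle chart at `p`. -/
def anchorCoord (p : M) (z : EM × F) : EM :=
  (trivializationAt EM (TangentSpace I) p
    (L.anchorMap ((bundleChart F V p).symm ((I.prod 𝓘(ℝ, F)).symm z)))).2

lemma contDiffOn_anchorCoord [I.Boundaryless] [ContMDiffVectorBundle ∞ F V I] (p : M) :
    ContDiffOn ℝ ∞ (L.anchorCoord p) (coordDomain I F V p) := by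
  intro z hz
  rw [← contMDiffWithinAt_iff_contDiffWithinAt]
  refine ContMDiffAt.contMDiffWithinAt ?_
  have h1 : ContMDiffAt 𝓘(ℝ, EM × F) (I.prod 𝓘(ℝ, F)) ∞ (I.prod 𝓘(ℝ, F)).symm z :=
    ((I.prod 𝓘(ℝ, F)).contMDiffOn_symm (n := ∞)).contMDiffAt
      (by rw [ModelWithCorners.range_eq_univ]; exact univ_mem)
  have h2 := (contMDiffAt_symm_of_mem_maximalAtlas
    (bundleChart_mem_maximalAtlas (I := I) (F := F) (V := V) p) hz).comp z h1
  have h3 := (L.contMDiff_anchor.contMDiffAt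
    (x := (bundleChart F V p).symm ((I.prod 𝓘(ℝ, F)).symm z))).comp z h2
  have hs : L.anchorMap ((bundleChart F V p).symm ((I.prod 𝓘(ℝ, F)).symm z)) ∈
      (trivializationAt EM (TangentSpace I) p).source := by
    rw [TangentBundle.trivializationAt_source]
    exact (mem_bundleChart_source_iff.1 ((bundleChart F V p).map_target hz)).2
  have h4 := ((trivializationAt EM (TangentSpace I) p).contMDiffOn (n := ∞) (IB := I)).contMDiffAt
    ((trivializationAt EM (TangentSpace I) p).open_source.mem_nhds hs)
  exact contMDiffAt_snd.comp z (h4.comp z h3)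

/-- The preferred trivialization of the tangent bundle at `p` acts on fibres as the differential of
the chart at `p`. This lets the chain rule compare `anchorCoord`, whose smoothness comes from the
bundle structure, with velocities in the chart. -/
lemma anchorCoord_apply {p : M} {a : TotalSpace F V}
    (ha : a ∈ (bundleChart (H := H) F V p).source) :
    L.anchorCoord p ((I.prod 𝓘(ℝ, F)) (bundleChart F V p a)) =
      mfderiv I 𝓘(ℝ, EM) (extChartAt I p) a.proj (L.anchor a.proj a.snd) := by
  have hp := (mem_bundleChart_source_iff.1 ha).2
  refine Eq.trans ?_ (DFunLike.congr_fun (TangentBundle.continuousLinearMapAt_trivializationAt hp)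
    (L.anchor a.proj a.snd))
  rw [anchorCoord, ModelWithCorners.left_inv, (bundleChart F V p).left_inv ha]
  exact (((trivializationAt EM (TangentSpace I) p).coe_linearMapAt_of_mem (R := ℝ)
    (show a.proj ∈ (trivializationAt EM (TangentSpace I) p).baseSet from hp)) ▸ rfl)

/-- Admissibility in the coordinates of a bundle chart. -/
lemma mfderiv_eq_anchor_iff {p : M} {a : ℝ → TotalSpace F V} {t : ℝ}
    [ContMDiffVectorBundle ∞ F V I]
    (ha : ContMDiffAt 𝓘(ℝ, ℝ) (I.prod 𝓘(ℝ, F)) ∞ a t)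
    (hs : a t ∈ (bundleChart (H := H) F V p).source) :
    mfderiv 𝓘(ℝ, ℝ) I (fun s => (a s).proj) t (1 : ℝ) = L.anchor (a t).proj (a t).snd ↔
      HasDerivAt (fun s => ((I.prod 𝓘(ℝ, F)) (bundleChart F V p (a s))).1)
        (L.anchorCoord p ((I.prod 𝓘(ℝ, F)) (bundleChart F V p (a t)))) t := by
  have hp := (mem_bundleChart_source_iff.1 hs).2
  have hp' : (a t).proj ∈ (extChartAt I p).source := by rwa [extChartAt_source]
  have h1 : ContMDiffAt 𝓘(ℝ, ℝ) I ∞ (fun s => (a s).proj) t :=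
    (contMDiff_proj V).contMDiffAt.comp t ha
  have h2 : MDifferentiableAt 𝓘(ℝ, ℝ) I (fun s => (a s).proj) t := h1.mdifferentiableAt (by simp)
  have h3 : MDifferentiableAt I 𝓘(ℝ, EM) (extChartAt I p) (a t).proj :=
    mdifferentiableAt_extChartAt hp
  have h4 := h3.hasMFDerivAt.comp t h2.hasMFDerivAt
  let T : ℝ →L[ℝ] EM := (mfderiv I 𝓘(ℝ, EM) (extChartAt I p) (a t).proj).comp
    (mfderiv 𝓘(ℝ, ℝ) I (fun s => (a s).proj) t)
  have h5 : HasFDerivAt (fun s => extChartAt I p (a s).proj) T t :=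
    hasMFDerivAt_iff_hasFDerivAt.1 h4
  have h6 : HasDerivAt (fun s => extChartAt I p (a s).proj)
      (mfderiv I 𝓘(ℝ, EM) (extChartAt I p) (a t).proj
        (mfderiv 𝓘(ℝ, ℝ) I (fun s => (a s).proj) t (1 : ℝ)) : EM) t :=
    h5.hasDerivAt
  have hev : (fun s => ((I.prod 𝓘(ℝ, F)) (bundleChart F V p (a s))).1) =ᶠ[𝓝 t]
      fun s => extChartAt I p (a s).proj := by
    filter_upwards [ha.continuousAt.eventually
      ((bundleChart F V p).open_source.mem_nhds hs)] with s hs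
    exact bundleChart_fst hs
  rw [hev.hasDerivAt_iff, L.anchorCoord_apply hs]
  -- Equality of velocities in the chart descends to the tangent space because the differential of a
  -- chart is invertible.
  have hinj : Function.Injective (mfderiv I 𝓘(ℝ, EM) (extChartAt I p) (a t).proj) := by
    obtain ⟨T, hT⟩ := isInvertible_mfderiv_extChartAt hp'
    rw [← hT]
    exact T.injective
  constructor
  · intro h
    rwa [h] at h6
  · intro h
    exact hinj (h6.unique h)

/-- The equation of admissible curves in the coordinates of the bundle chart at `p`. -/
def localField (p : M) (z : EM × F) : EM × F := (L.anchorCoord p z, 0)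

lemma contDiffOn_localField [I.Boundaryless] [ContMDiffVectorBundle ∞ F V I] (p : M) :
    ContDiffOn ℝ ∞ (L.localField p) (coordDomain I F V p) :=
  (L.contDiffOn_anchorCoord p).prodMk contDiffOn_const

lemma IsAdmissible.isProlonged_derivs [I.Boundaryless] [ContMDiffVectorBundle ∞ F V I]
    {L : LieAlgebroid I F V} {a : Curve (I.prod 𝓘(ℝ, F)) (TotalSpace F V)} (ha : L.IsAdmissible a)
    {p : M} (hp : a.toFun 0 ∈ (bundleChart (H := H) F V p).source) (r : ℕ) :
    IsProlonged (L.localField p) (a.derivs r (bundleChart F V p)) := by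
  refine isProlonged_of_hasDerivAt (g := L.localField p)
    (c := fun t => (I.prod 𝓘(ℝ, F)) (bundleChart F V p (a.toFun t))) r ?_
    (a.contDiffAt_chart (bundleChart_mem_maximalAtlas p) hp) ?_
  · exact (L.contDiffOn_localField p).contDiffAt
      ((isOpen_coordDomain p).mem_nhds (mem_coordDomain hp))
  · filter_upwards [ha, a.smooth, a.smooth.self_of_nhds.continuousAt.eventually
      ((bundleChart F V p).open_source.mem_nhds hp)] with t h1 h2 h3
    exact (L.mfderiv_eq_anchor_iff h2 h3).1 h1

/-- The fibre component y is the polynomial with the prescribed derivatives, and x solves x' = ρ(x,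
y) with the prescribed initial value. Boundarylessness ensures that the resulting coordinate curve
lies in the range of the model. -/
lemma exists_isAdmissible [I.Boundaryless] [ContMDiffVectorBundle ∞ F V I] [CompleteSpace EM]
    {p : M} {r : ℕ} {v : Fin (r + 1) → EM × F} (h0 : v 0 ∈ coordDomain I F V p)
    (hv : IsProlonged (L.localField p) v) :
    ∃ a : Curve (I.prod 𝓘(ℝ, F)) (TotalSpace F V), L.IsAdmissible a ∧
      a.toFun 0 = (bundleChart F V p).symm ((I.prod 𝓘(ℝ, F)).symm (v 0)) ∧
      a.derivs r (bundleChart F V p) = v := by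
  set e : OpenPartialHomeomorph (TotalSpace F V) (ModelProd H F) := bundleChart F V p with he
  set y : ℝ → F := polyCurve fun i => (v i).2 with hy
  have hy0 : y 0 = (v 0).2 := polyCurve_zero _
  obtain ⟨x, hx0, hx⟩ := exists_smooth_solution (isOpen_coordDomain p)
    (L.contDiffOn_anchorCoord p) (contDiff_polyCurve fun i => (v i).2) (x₀ := (v 0).1)
    (by rw [← hy, hy0]; exact h0)
  rw [← hy] at hx
  have hsm : ∀ᶠ t in 𝓝 (0 : ℝ), ContMDiffAt 𝓘(ℝ, ℝ) (I.prod 𝓘(ℝ, F)) ∞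
      (fun t => e.symm ((I.prod 𝓘(ℝ, F)).symm (x t, y t))) t := by
    filter_upwards [hx] with t ht
    have h1 : ContMDiffAt 𝓘(ℝ, ℝ) 𝓘(ℝ, EM × F) ∞ (fun t => (x t, y t)) t :=
      (ht.2.2.prodMk (contDiff_polyCurve _).contDiffAt).contMDiffAt
    have h2 : ContMDiffAt 𝓘(ℝ, EM × F) (I.prod 𝓘(ℝ, F)) ∞ (I.prod 𝓘(ℝ, F)).symm (x t, y t) :=
      ((I.prod 𝓘(ℝ, F)).contMDiffOn_symm (n := ∞)).contMDiffAt
        (by rw [ModelWithCorners.range_eq_univ]; exact univ_mem)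
    exact (contMDiffAt_symm_of_mem_maximalAtlas (bundleChart_mem_maximalAtlas p) ht.1).comp t
      (h2.comp t h1)
  let a : Curve (I.prod 𝓘(ℝ, F)) (TotalSpace F V) := ⟨_, hsm⟩
  have hc : (fun t => (I.prod 𝓘(ℝ, F)) (e (a.toFun t))) =ᶠ[𝓝 0] fun t => (x t, y t) := by
    filter_upwards [hx] with t ht
    change (I.prod 𝓘(ℝ, F)) (e (e.symm ((I.prod 𝓘(ℝ, F)).symm (x t, y t)))) = _
    rw [e.right_inv ht.1, ModelWithCorners.right_inv]
    rw [ModelWithCorners.range_eq_univ]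
    exact mem_univ _
  have hadm : L.IsAdmissible a := by
    filter_upwards [hx, hsm, hc.eventuallyEq_nhds] with t h1 h2 h3
    rw [L.mfderiv_eq_anchor_iff (p := p) h2 (e.map_target h1.1)]
    have h4 : (I.prod 𝓘(ℝ, F)) (bundleChart F V p (a.toFun t)) = (x t, y t) := h3.self_of_nhds
    rw [h4]
    exact h1.2.1.congr_of_eventuallyEq (h3.fun_comp Prod.fst)
  have ha0 : a.toFun 0 = e.symm ((I.prod 𝓘(ℝ, F)).symm (v 0)) := by
    change e.symm ((I.prod 𝓘(ℝ, F)).symm (x 0, y 0)) = _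
    rw [hx0, hy0]
  refine ⟨a, hadm, ha0, ?_⟩
  have hs : a.toFun 0 ∈ e.source := by
    rw [ha0]
    exact e.map_target h0
  -- The higher derivatives of x are never computed: `v` and the jet of `a` both satisfy the
  -- prolonged equations, so matching free coordinates suffices.
  have hu := (hadm.isProlonged_derivs hs r).eq_prolong
  rw [← hu, ← hv.eq_prolong]
  congr 1
  have hd : ∀ i, a.derivs r e i = iteratedDeriv i (fun t => (x t, y t)) 0 := fun i =>
    hc.iteratedDeriv_eq _
  rw [← he]
  simp only [freeCoord_apply, hd]
  refine Prod.ext ?_ (funext fun i => ?_)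
  · simp [hx0]
  · have h1 : ContDiffAt ℝ ∞ (fun t => (x t, y t)) 0 :=
      hx.self_of_nhds.2.2.prodMk (contDiff_polyCurve _).contDiffAt
    have h2 := iteratedDeriv_clm_comp (ContinuousLinearMap.snd ℝ EM F) h1 i
    simp only [ContinuousLinearMap.coe_snd'] at h2
    change (iteratedDeriv i (fun t => (x t, y t)) 0).2 = (v i).2
    rw [← h2]
    exact iteratedDeriv_polyCurve (fun i => (v i).2) i

/-- The equations of `E^k` in the natural coordinates induced by a bundle chart. -/
theorem mem_jets_iff [I.Boundaryless] [ContMDiffVectorBundle ∞ F V I] [CompleteSpace EM]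
    {p : M} {k : ℕ} {q : HigherTangent (I.prod 𝓘(ℝ, F)) (TotalSpace F V) (k - 1)}
    (hq : q.base ∈ (bundleChart (H := H) F V p).source) :
    q ∈ L.jets k ↔ IsProlonged (L.localField p) (q.coord (bundleChart F V p)) := by
  have he := bundleChart_mem_maximalAtlas (I := I) (F := F) (V := V) p
  constructor
  · rintro ⟨a, ha, rfl⟩
    rw [HigherTangent.coord_jet he hq]
    exact ha.isProlonged_derivs hq _
  · revert hq
    refine Quotient.inductionOn q fun γ hγ h => ?_
    change γ.toFun 0 ∈ _ at hγ
    change IsProlonged _ (HigherTangent.coord _ (jet (k - 1) γ)) at h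
    rw [HigherTangent.coord_jet he hγ] at h
    have h0 : γ.derivs (k - 1) (bundleChart F V p) 0 =
        (I.prod 𝓘(ℝ, F)) (bundleChart F V p (γ.toFun 0)) := by simp [Curve.derivs]
    obtain ⟨a, ha, ha0, hd⟩ := L.exists_isAdmissible (by rw [h0]; exact mem_coordDomain hγ) h
    rw [h0, ModelWithCorners.left_inv, (bundleChart F V p).left_inv hγ] at ha0
    exact ⟨a, ha, (jet_eq_iff he (ha0 ▸ hγ)).2 ⟨ha0, hd⟩⟩

end LieAlgebroid

/-! ### Natural charts of higher order tangent manifolds -/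

namespace JetBundle.HigherTangent

variable {E : Type*} [NormedAddCommGroup E] [NormedSpace ℝ E]
  {H : Type*} [TopologicalSpace H] {I : ModelWithCorners ℝ E H} [I.Boundaryless]
  {N : Type*} [TopologicalSpace N] [ChartedSpace H N] [IsManifold I ∞ N]
  {e : OpenPartialHomeomorph N H} (he : e ∈ IsManifold.maximalAtlas I ∞ N) {r : ℕ}

/-- The natural chart of `T^r N` induced by a chart `e` of `N`, as an open partial homeomorphism. -/
def natChart (r : ℕ) : OpenPartialHomeomorph (HigherTangent I N r) (Fin (r + 1) → E) :=
  (core I N r).openPartialHomeomorph (chart r e he) ⟨e, he, rfl⟩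

@[simp] lemma natChart_apply (q : HigherTangent I N r) : natChart he r q = coord e q := rfl

lemma mem_natChart_source {q : HigherTangent I N r} :
    q ∈ (natChart he r).source ↔ q.base ∈ e.source := Iff.rfl

lemma natChart_mem_maximalAtlas :
    natChart he r ∈ IsManifold.maximalAtlas 𝓘(ℝ, Fin (r + 1) → E) ∞ (HigherTangent I N r) := by
  refine IsManifold.subset_maximalAtlas ?_
  change _ ∈ ⋃ (d) (hd : d ∈ (core I N r).atlas), {(core I N r).openPartialHomeomorph d hd}
  simp only [mem_iUnion, mem_singleton_iff]
  exact ⟨_, ⟨e, he, rfl⟩, rfl⟩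

include he in
lemma coord_zero {q : HigherTangent I N r} (hq : q.base ∈ e.source) :
    coord e q 0 = I (e q.base) := by
  revert hq
  refine Quotient.inductionOn q fun γ hγ => ?_
  change coord e (jet r γ) 0 = _
  rw [coord_jet he hγ]
  simp only [Curve.derivs, Fin.val_zero, iteratedDeriv_zero]
  rfl

include he in
lemma coord_injOn {q q' : HigherTangent I N r} (hq : q.base ∈ e.source) (hq' : q'.base ∈ e.source)
    (h : coord e q = coord e q') : q = q' :=
  (natChart he r).injOn hq hq' h

omit [I.Boundaryless] [IsManifold I ∞ N] in
@[simp] lemma base_proj {s : ℕ} (h : s ≤ r) (q : HigherTangent I N r) :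
    (proj h q).base = q.base :=
  Quotient.inductionOn q fun _ => rfl

include he in
lemma coord_proj {s : ℕ} (h : s ≤ r) {q : HigherTangent I N r} (hq : q.base ∈ e.source) :
    coord e (proj h q) = fun i => coord e q (Fin.castLE (Nat.succ_le_succ h) i) := by
  revert hq
  refine Quotient.inductionOn q fun γ hγ => ?_
  change coord e (jet s γ) = fun i => coord e (jet r γ) _
  rw [coord_jet he hγ, coord_jet he hγ]
  rfl

include he in
lemma coord_change {e' : OpenPartialHomeomorph N H} (he' : e' ∈ IsManifold.maximalAtlas I ∞ N)
    {q : HigherTangent I N r} (hq : q.base ∈ e.source) (hq' : q.base ∈ e'.source) :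
    coord e' q = changeCoord r (fun x => I (e' (e.symm (I.symm x)))) (coord e q) := by
  revert hq hq'
  refine Quotient.inductionOn q fun γ hγ hγ' => ?_
  change coord e' (jet r γ) = changeCoord r _ (coord e (jet r γ))
  rw [coord_jet he hγ, coord_jet he' hγ', γ.derivs_change r he he' hγ hγ']

lemma continuous_base : Continuous (base : HigherTangent I N r → N) := by
  rw [continuous_iff_continuousAt]
  intro q
  have he := IsManifold.chart_mem_maximalAtlas (I := I) (n := ∞) q.base
  have hq : q ∈ (natChart he r).source := mem_chart_source H q.base
  have h1 : ContinuousAt (fun q' : HigherTangent I N r =>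
      (chartAt H q.base).symm (I.symm (natChart he r q' 0))) q := by
    refine ContinuousAt.comp ?_ (I.continuous_symm.continuousAt.comp
      ((continuous_apply 0).continuousAt.comp ((natChart he r).continuousAt hq)))
    refine (chartAt H q.base).continuousAt_symm ?_
    exact (natChart he r).map_source hq
  refine h1.congr_of_eventuallyEq ?_
  filter_upwards [(natChart he r).open_source.mem_nhds hq] with q' hq'
  rw [natChart_apply, coord_zero he hq', ModelWithCorners.left_inv,
    (chartAt H q.base).left_inv hq']

lemma contMDiff_proj {s : ℕ} (h : s ≤ r) :
    ContMDiff 𝓘(ℝ, Fin (r + 1) → E) 𝓘(ℝ, Fin (s + 1) → E) ∞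
      (proj h : HigherTangent I N r → HigherTangent I N s) := by
  intro q
  have he := IsManifold.chart_mem_maximalAtlas (I := I) (n := ∞) q.base
  have hq : q ∈ (natChart he r).source := mem_chart_source H q.base
  have h1 : ContMDiff 𝓘(ℝ, Fin (r + 1) → E) 𝓘(ℝ, Fin (s + 1) → E) ∞
      fun (v : Fin (r + 1) → E) (i : Fin (s + 1)) => v (Fin.castLE (Nat.succ_le_succ h) i) := by
    refine ContDiff.contMDiff ?_
    fun_prop
  have h2 : ContMDiffAt 𝓘(ℝ, Fin (r + 1) → E) 𝓘(ℝ, Fin (s + 1) → E) ∞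
      (fun q' : HigherTangent I N r => (natChart he s).symm
        fun i => natChart he r q' (Fin.castLE (Nat.succ_le_succ h) i)) q := by
    refine (contMDiffAt_symm_of_mem_maximalAtlas (natChart_mem_maximalAtlas he) ?_).comp q
      (h1.contMDiffAt.comp q (contMDiffAt_of_mem_maximalAtlas (natChart_mem_maximalAtlas he) hq))
    exact (natChart he r).map_source hq
  refine h2.congr_of_eventuallyEq ?_
  filter_upwards [(natChart he r).open_source.mem_nhds hq] with q' hq'
  have h3 : proj h q' ∈ (natChart he s).source := by
    rw [mem_natChart_source, base_proj]
    exact hq'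
  rw [← (natChart he s).left_inv h3]
  congr 1
  exact coord_proj he h hq'

end JetBundle.HigherTangent

/-- A space is Hausdorff if it maps continuously to a Hausdorff space such that any two points with
the same image lie in a common chart. -/
lemma t2Space_of_charts {X Y Z : Type*} [TopologicalSpace X] [TopologicalSpace Y]
    [TopologicalSpace Z] [T2Space Y] [T2Space Z] {f : X → Y} (hf : Continuous f)
    (h : ∀ x y, f x = f y → ∃ e : OpenPartialHomeomorph X Z, x ∈ e.source ∧ y ∈ e.source) :
    T2Space X := by
  refine ⟨fun x y hxy => ?_⟩
  by_cases hfxy : f x = f y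
  · obtain ⟨e, hx, hy⟩ := h x y hfxy
    obtain ⟨u, v, hu, hv, hxu, hyv, huv⟩ := t2_separation fun h => hxy (e.injOn hx hy h)
    refine ⟨e.source ∩ e ⁻¹' u, e.source ∩ e ⁻¹' v, e.isOpen_inter_preimage hu,
      e.isOpen_inter_preimage hv, ⟨hx, hxu⟩, ⟨hy, hyv⟩, ?_⟩
    exact (huv.preimage e).mono inter_subset_right inter_subset_right
  · obtain ⟨u, v, hu, hv, hxu, hyv, huv⟩ := t2_separation hfxy
    exact ⟨f ⁻¹' u, f ⁻¹' v, hu.preimage hf, hv.preimage hf, hxu, hyv, huv.preimage f⟩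

/-! ### `E^k` as an embedded submanifold of `T^{k-1} E`. -/

namespace LieAlgebroid

variable {EM : Type*} [NormedAddCommGroup EM] [NormedSpace ℝ EM]
  {H : Type*} [TopologicalSpace H] {I : ModelWithCorners ℝ EM H} [I.Boundaryless]
  {M : Type*} [TopologicalSpace M] [ChartedSpace H M] [IsManifold I ∞ M]
  {F : Type*} [NormedAddCommGroup F] [NormedSpace ℝ F]
  {V : M → Type*} [TopologicalSpace (TotalSpace F V)]
  [∀ x, AddCommGroup (V x)] [∀ x, Module ℝ (V x)] [∀ x, TopologicalSpace (V x)]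
  [FiberBundle F V] [VectorBundle ℝ F V] [ContMDiffVectorBundle ∞ F V I]

variable (I F V) in
/-- The natural chart of `T^r E` induced by the bundle chart of `E` at `p`. -/
def jetChart (p : M) (r : ℕ) : OpenPartialHomeomorph
    (HigherTangent (I.prod 𝓘(ℝ, F)) (TotalSpace F V) r) (Fin (r + 1) → EM × F) :=
  HigherTangent.natChart (bundleChart_mem_maximalAtlas (I := I) (F := F) (V := V) p) r

lemma jetChart_mem_maximalAtlas (p : M) (r : ℕ) :
    jetChart I F V p r ∈ IsManifold.maximalAtlas 𝓘(ℝ, Fin (r + 1) → EM × F) ∞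
      (HigherTangent (I.prod 𝓘(ℝ, F)) (TotalSpace F V) r) :=
  HigherTangent.natChart_mem_maximalAtlas _

lemma jetChart_apply (p : M) (r : ℕ)
    (q : HigherTangent (I.prod 𝓘(ℝ, F)) (TotalSpace F V) r) :
    jetChart I F V p r q = q.coord (bundleChart F V p) := rfl

lemma mem_jetChart_source {p : M} {r : ℕ}
    {q : HigherTangent (I.prod 𝓘(ℝ, F)) (TotalSpace F V) r} :
    q ∈ (jetChart I F V p r).source ↔ q.base ∈ (bundleChart (H := H) F V p).source := Iff.rfl

lemma mem_jetChart_target {p : M} {r : ℕ} {v : Fin (r + 1) → EM × F} :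
    v ∈ (jetChart I F V p r).target ↔ v 0 ∈ coordDomain I F V p := Iff.rfl

lemma coord_zero_mem_coordDomain {p : M} {r : ℕ}
    {q : HigherTangent (I.prod 𝓘(ℝ, F)) (TotalSpace F V) r}
    (hq : q.base ∈ (bundleChart (H := H) F V p).source) :
    q.coord (bundleChart F V p) 0 ∈ coordDomain I F V p :=
  (jetChart I F V p r).map_source hq

/-- The comparison map goes down to `M` rather than to `E`. Bundle chart domains contain whole
fibres of `E`, so two jets over the same point of `M` share a natural chart. -/
lemma t2Space_higherTangent [T2Space M] (r : ℕ) :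
    T2Space (HigherTangent (I.prod 𝓘(ℝ, F)) (TotalSpace F V) r) := by
  refine t2Space_of_charts (Y := M) (Z := Fin (r + 1) → EM × F) (f := fun q => (HigherTangent.base q).proj)
    ((FiberBundle.continuous_proj F V).comp HigherTangent.continuous_base) fun q q' h => ?_
  refine ⟨jetChart I F V q.base.proj r, mem_bundleChart_source q.base, ?_⟩
  rw [mem_jetChart_source, h]
  exact mem_bundleChart_source q'.base

/-- Countably many bundle chart domains cover `M`, and the natural charts over them have
finite-dimensional model spaces. -/
lemma secondCountableTopology_higherTangent [FiniteDimensional ℝ EM] [FiniteDimensional ℝ F]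
    [SecondCountableTopology M] (r : ℕ) :
    SecondCountableTopology (HigherTangent (I.prod 𝓘(ℝ, F)) (TotalSpace F V) r) := by
  obtain ⟨t, ht, hcov⟩ := TopologicalSpace.countable_cover_nhds fun x : M =>
    inter_mem ((trivializationAt F V x).open_baseSet.mem_nhds (mem_baseSet_trivializationAt F V x))
      ((chartAt H x).open_source.mem_nhds (mem_chart_source H x))
  have := ht.to_subtype
  have (i : t) : SecondCountableTopology (jetChart I F V i.1 r).source :=
    (jetChart I F V i.1 r).secondCountableTopology_source
  refine TopologicalSpace.secondCountableTopology_of_countable_cover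
    (U := fun i : t => (jetChart I F V i.1 r).source)
    (fun i => (jetChart I F V i.1 r).open_source) ?_
  refine eq_univ_of_forall fun q => ?_
  have hq : q.base.proj ∈ ⋃ x ∈ t, (trivializationAt F V x).baseSet ∩ (chartAt H x).source := by
    rw [hcov]
    exact mem_univ _
  simp only [mem_iUnion] at hq ⊢
  obtain ⟨x, hx, hq⟩ := hq
  exact ⟨⟨x, hx⟩, mem_bundleChart_source_iff.2 hq⟩

/-- `E^k` as a submanifold of `T^{k-1} E`. -/
def jetsSliceData [CompleteSpace EM] (L : LieAlgebroid I F V) (k : ℕ)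
    {W : Type*} [NormedAddCommGroup W] [NormedSpace ℝ W]
    (Λ : (EM × (Fin (k - 1 + 1) → F)) ≃L[ℝ] W) :
    SliceData (E' := Fin (k - 1 + 1) → EM × F) (L.jets k) W where
  proj := (Λ : (EM × (Fin (k - 1 + 1) → F)) →L[ℝ] W).comp (freeCoord EM F (k - 1))
  -- The right inverse repeats x in every order. This choice is harmless, since `freeCoord` reads x
  -- only in order 0.
  lift := (ContinuousLinearMap.pi fun i => (ContinuousLinearMap.fst ℝ EM _).prod
    ((ContinuousLinearMap.proj i).comp (ContinuousLinearMap.snd ℝ EM _))).comp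
      (Λ.symm : W →L[ℝ] EM × (Fin (k - 1 + 1) → F))
  proj_lift w := by simp
  chart q := jetChart I F V q.1.base.proj (k - 1)
  chart_mem q := jetChart_mem_maximalAtlas _ _
  mem_source q := mem_bundleChart_source _
  dom q := Λ.symm ⁻¹' ((fun w => (w.1, w.2 0)) ⁻¹' coordDomain I F V q.1.base.proj)
  isOpen_dom q := ((isOpen_coordDomain _).preimage (by fun_prop)).preimage Λ.symm.continuous
  sec q w := prolong (L.localField q.1.base.proj) (k - 1) (Λ.symm w)
  contDiffOn_sec q := (contDiffOn_prolong (isOpen_coordDomain _)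
    (L.contDiffOn_localField _) (k - 1)).comp Λ.symm.contDiff.contDiffOn fun _ h => h
  proj_sec q w _ := by
    simp only [ContinuousLinearMap.comp_apply, freeCoord_prolong]
    exact Λ.apply_symm_apply w
  sec_mem q w hw := by
    rw [mem_jetChart_target, prolong_zero_apply]
    exact hw
  symm_sec_mem q w hw := by
    have hv : prolong (L.localField q.1.base.proj) (k - 1) (Λ.symm w) ∈
        (jetChart I F V q.1.base.proj (k - 1)).target := by
      rw [mem_jetChart_target, prolong_zero_apply]
      exact hw
    rw [L.mem_jets_iff ((jetChart I F V q.1.base.proj (k - 1)).map_target hv), ← jetChart_apply,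
      (jetChart I F V q.1.base.proj (k - 1)).right_inv hv]
    exact isProlonged_prolong _ _ _
  proj_mem i q _ hs := by
    simpa [jetChart_apply] using coord_zero_mem_coordDomain hs
  sec_proj i q hq hs := by
    have h := (L.mem_jets_iff hs).1 hq
    simp only [ContinuousLinearMap.comp_apply, jetChart_apply]
    refine Eq.trans ?_ h.eq_prolong
    congr 1
    exact Λ.symm_apply_apply _

end LieAlgebroid

/-! ### Free coordinates of jets of different orders -/

section FreeCoordinates

variable {X : Type*} [NormedAddCommGroup X] [NormedSpace ℝ X]
  {Y : Type*} [NormedAddCommGroup Y] [NormedSpace ℝ Y]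

/-- The derivatives of `y` of orders `s + 1, …, r`. -/
def tailCoord {r s : ℕ} (h : s ≤ r) : (Fin (r + 1) → X × Y) →L[ℝ] (Fin (r - s) → Y) :=
  ContinuousLinearMap.pi fun j =>
    (ContinuousLinearMap.snd ℝ X Y).comp (ContinuousLinearMap.proj ⟨s + 1 + j, by omega⟩)

/-- The free coordinates of order `r`, assembled from those of order `s` and the derivatives of `y`
of higher order. -/
def mergeCoord {r s : ℕ} (h : s ≤ r) (w : X × (Fin (s + 1) → Y)) (z : Fin (r - s) → Y) :
    X × (Fin (r + 1) → Y) :=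
  (w.1, fun i => if hi : (i : ℕ) < s + 1 then w.2 ⟨i, hi⟩ else z ⟨i - (s + 1), by omega⟩)

lemma contDiff_mergeCoord {r s : ℕ} (h : s ≤ r) :
    ContDiff ℝ ∞ fun p : (X × (Fin (s + 1) → Y)) × (Fin (r - s) → Y) =>
      mergeCoord h p.1 p.2 := by
  refine (contDiff_fst.comp contDiff_fst).prodMk (contDiff_pi.2 fun i => ?_)
  split_ifs <;> fun_prop

lemma mergeCoord_freeCoord {r s : ℕ} (h : s ≤ r) (v : Fin (r + 1) → X × Y) :
    mergeCoord h (freeCoord X Y s fun i => v (Fin.castLE (Nat.succ_le_succ h) i))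
      (tailCoord h v) = freeCoord X Y r v := by
  refine Prod.ext rfl (funext fun i => ?_)
  simp only [mergeCoord, freeCoord_apply]
  split_ifs with hi
  · rfl
  · change (v ⟨s + 1 + ((i : ℕ) - (s + 1)), _⟩).2 = (v i).2
    congr 2
    exact Fin.ext (by simp only; omega)

lemma tailCoord_prolong_mergeCoord {r s : ℕ} (h : s ≤ r) (g : X × Y → X × Y)
    (w : X × (Fin (s + 1) → Y)) (z : Fin (r - s) → Y) :
    tailCoord h (prolong g r (mergeCoord h w z)) = z := by
  funext j
  have h1 := congrFun (congrArg Prod.snd (freeCoord_prolong g r (mergeCoord h w z)))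
    ⟨s + 1 + j, by omega⟩
  refine h1.trans ?_
  simp only [mergeCoord]
  rw [dif_neg (by omega)]
  congr 1
  exact Fin.ext (by simp only; omega)

/-- Truncating a solution gives a solution of lower order, so by uniqueness only free coordinates
need comparison. This is why the trivializations below lie over the prescribed point of `E^l`. -/
lemma prolong_mergeCoord_castLE {r s : ℕ} (h : s ≤ r) (g : X × Y → X × Y)
    (w : X × (Fin (s + 1) → Y)) (z : Fin (r - s) → Y) :
    (fun i => prolong g r (mergeCoord h w z) (Fin.castLE (Nat.succ_le_succ h) i)) =
      prolong g s w := by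
  rw [← ((isProlonged_prolong g r (mergeCoord h w z)).restrict h).eq_prolong]
  congr 1
  have h1 := freeCoord_prolong g r (mergeCoord h w z)
  refine Prod.ext (congrArg Prod.fst h1 :) (funext fun i => ?_)
  refine (congrFun (congrArg Prod.snd h1) (Fin.castLE (Nat.succ_le_succ h) i)).trans ?_
  exact dif_pos i.2

/-- In a jet satisfying the prolonged equations, the derivative of `x` of highest order is
determined by the derivatives of lower order. -/
lemma IsProlonged.fst_last_eq {r : ℕ} (hr : 0 < r) {g : X × Y → X × Y}
    {v v' : Fin (r + 1) → X × Y} (hv : IsProlonged g v) (hv' : IsProlonged g v')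
    (h : ∀ i, i ≠ Fin.last r → v i = v' i) : (v (Fin.last r)).1 = (v' (Fin.last r)).1 := by
  obtain ⟨n, rfl⟩ : ∃ n, r = n + 1 := ⟨r - 1, by omega⟩
  have h1 : (Fin.init v : Fin (n + 1) → X × Y) = Fin.init v' :=
    funext fun i => h _ (Fin.castSucc_lt_last i).ne
  rw [(isProlonged_succ_iff.1 hv).2, (isProlonged_succ_iff.1 hv').2, h1]

end FreeCoordinates

/-! ### Local trivializations of `E^k → E^l`. -/

namespace LieAlgebroid

variable {EM : Type*} [NormedAddCommGroup EM] [NormedSpace ℝ EM]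
  {H : Type*} [TopologicalSpace H] {I : ModelWithCorners ℝ EM H}
  {M : Type*} [TopologicalSpace M] [ChartedSpace H M] [IsManifold I ∞ M]
  {F : Type*} [NormedAddCommGroup F] [NormedSpace ℝ F]
  {V : M → Type*} [TopologicalSpace (TotalSpace F V)]
  [∀ x, AddCommGroup (V x)] [∀ x, Module ℝ (V x)] [∀ x, TopologicalSpace (V x)]
  [FiberBundle F V] [VectorBundle ℝ F V] (L : LieAlgebroid I F V)

/-- An admissible curve representing the lower jet also represents a higher one over it. -/
lemma jetsProj_surjective {k l : ℕ} (h : l ≤ k) : Function.Surjective (L.jetsProj h) := by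
  rintro ⟨_, a, ha, rfl⟩
  exact ⟨⟨jet (k - 1) a, a, ha, rfl⟩, rfl⟩

lemma coe_jetsProj {k l : ℕ} (h : l ≤ k) (q : L.jets k) :
    (L.jetsProj h q : HigherTangent _ _ _) = HigherTangent.proj (Nat.sub_le_sub_right h 1) q.1 :=
  rfl

lemma base_jetsProj {k l : ℕ} (h : l ≤ k) (q : L.jets k) :
    (L.jetsProj h q).1.base = q.1.base :=
  HigherTangent.base_proj (Nat.sub_le_sub_right h 1) q.1

variable [I.Boundaryless] [ContMDiffVectorBundle ∞ F V I] [CompleteSpace EM]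

section Trivialization

variable {Φ : Type*} [NormedAddCommGroup Φ] [NormedSpace ℝ Φ]
  {k l : ℕ} (h : l ≤ k) (Θ : Φ ≃L[ℝ] (Fin (k - 1 - (l - 1)) → F)) (p : M)

/-- The coordinates of the jet in `E^k` over `b` with free coordinates `w` of higher order. -/
def fibreCoord (b : L.jets l) (w : Φ) : Fin (k - 1 + 1) → EM × F :=
  prolong (L.localField p) (k - 1) (mergeCoord (Nat.sub_le_sub_right h 1)
    (freeCoord EM F (l - 1) (b.1.coord (bundleChart F V p))) (Θ w))

variable {p}

omit [I.Boundaryless] [ContMDiffVectorBundle ∞ F V I] [CompleteSpace EM] in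
lemma fibreCoord_zero (b : L.jets l) (w : Φ) :
    L.fibreCoord h Θ p b w 0 = b.1.coord (bundleChart F V p) 0 := by
  rw [fibreCoord, prolong_zero_apply]
  simp [mergeCoord]

omit [CompleteSpace EM] in
lemma fibreCoord_mem {b : L.jets l} (hb : b.1.base ∈ (bundleChart (H := H) F V p).source) (w : Φ) :
    L.fibreCoord h Θ p b w ∈ (jetChart I F V p (k - 1)).target := by
  rw [mem_jetChart_target, fibreCoord_zero]
  exact coord_zero_mem_coordDomain hb

lemma symm_fibreCoord_mem {b : L.jets l} (hb : b.1.base ∈ (bundleChart (H := H) F V p).source)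
    (w : Φ) : (jetChart I F V p (k - 1)).symm (L.fibreCoord h Θ p b w) ∈ L.jets k := by
  have hv := L.fibreCoord_mem h Θ hb w
  rw [L.mem_jets_iff ((jetChart I F V p (k - 1)).map_target hv), ← jetChart_apply,
    (jetChart I F V p (k - 1)).right_inv hv]
  exact isProlonged_prolong _ _ _

lemma fibreCoord_castLE {b : L.jets l} (hb : b.1.base ∈ (bundleChart (H := H) F V p).source)
    (w : Φ) : (fun i => L.fibreCoord h Θ p b w
      (Fin.castLE (Nat.succ_le_succ (Nat.sub_le_sub_right h 1)) i)) =
        b.1.coord (bundleChart F V p) := by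
  unfold fibreCoord
  rw [prolong_mergeCoord_castLE]
  exact ((L.mem_jets_iff hb).1 b.2).eq_prolong

open Classical in
/-- The inverse of the local trivialization of `E^k → E^l` at `p`. -/
def trivInv (p : M) (x : L.jets l × Φ) : L.jets k :=
  if hb : x.1.1.base ∈ (bundleChart (H := H) F V p).source then
    ⟨(jetChart I F V p (k - 1)).symm (L.fibreCoord h Θ p x.1 x.2),
      L.symm_fibreCoord_mem h Θ hb x.2⟩
  -- A default value outside the base set, where no condition is imposed.
  else Function.surjInv (L.jetsProj_surjective h) x.1

lemma coe_trivInv {x : L.jets l × Φ} (hb : x.1.1.base ∈ (bundleChart (H := H) F V p).source) :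
    (L.trivInv h Θ p x).1 =
      (jetChart I F V p (k - 1)).symm (L.fibreCoord h Θ p x.1 x.2) := by
  rw [trivInv, dif_pos hb]

lemma base_trivInv_mem {x : L.jets l × Φ}
    (hb : x.1.1.base ∈ (bundleChart (H := H) F V p).source) :
    (L.trivInv h Θ p x).1.base ∈ (bundleChart (H := H) F V p).source := by
  rw [L.coe_trivInv h Θ hb]
  exact (jetChart I F V p (k - 1)).map_target (L.fibreCoord_mem h Θ hb x.2)

lemma coord_trivInv {x : L.jets l × Φ}
    (hb : x.1.1.base ∈ (bundleChart (H := H) F V p).source) :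
    (L.trivInv h Θ p x).1.coord (bundleChart F V p) = L.fibreCoord h Θ p x.1 x.2 := by
  rw [L.coe_trivInv h Θ hb, ← jetChart_apply]
  exact (jetChart I F V p (k - 1)).right_inv (L.fibreCoord_mem h Θ hb x.2)

lemma jetsProj_trivInv {x : L.jets l × Φ}
    (hb : x.1.1.base ∈ (bundleChart (H := H) F V p).source) :
    L.jetsProj h (L.trivInv h Θ p x) = x.1 := by
  have he := bundleChart_mem_maximalAtlas (I := I) (F := F) (V := V) p
  have h1 := L.base_trivInv_mem h Θ hb
  refine Subtype.ext (HigherTangent.coord_injOn he ?_ hb ?_)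
  · rw [base_jetsProj]
    exact h1
  · rw [coe_jetsProj, HigherTangent.coord_proj he _ h1, L.coord_trivInv h Θ hb]
    exact L.fibreCoord_castLE h Θ hb x.2

variable (p) in
/-- The local trivialization of `E^k → E^l` at `p`, as a function. -/
def trivFun (q : L.jets k) : L.jets l × Φ :=
  (L.jetsProj h q, Θ.symm (tailCoord (Nat.sub_le_sub_right h 1) (q.1.coord (bundleChart F V p))))

lemma trivInv_trivFun {q : L.jets k} (hq : q.1.base ∈ (bundleChart (H := H) F V p).source) :
    L.trivInv h Θ p (L.trivFun h Θ p q) = q := by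
  have he := bundleChart_mem_maximalAtlas (I := I) (F := F) (V := V) p
  have hb : (L.trivFun h Θ p q).1.1.base ∈ (bundleChart (H := H) F V p).source := by
    rw [trivFun, base_jetsProj]
    exact hq
  refine Subtype.ext (HigherTangent.coord_injOn he (L.base_trivInv_mem h Θ hb) hq ?_)
  rw [L.coord_trivInv h Θ hb, fibreCoord, trivFun, coe_jetsProj, HigherTangent.coord_proj he _ hq,
    Θ.apply_symm_apply, mergeCoord_freeCoord]
  exact ((L.mem_jets_iff hq).1 q.2).eq_prolong

lemma trivFun_trivInv {x : L.jets l × Φ}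
    (hb : x.1.1.base ∈ (bundleChart (H := H) F V p).source) :
    L.trivFun h Θ p (L.trivInv h Θ p x) = x := by
  rw [trivFun, L.jetsProj_trivInv h Θ hb, L.coord_trivInv h Θ hb, fibreCoord,
    tailCoord_prolong_mergeCoord, Θ.symm_apply_apply]

variable {Wk : Type*} [NormedAddCommGroup Wk] [NormedSpace ℝ Wk] [ChartedSpace Wk (L.jets k)]
  [IsManifold 𝓘(ℝ, Wk) ∞ (L.jets k)]
  (hk : Manifold.IsSmoothEmbedding 𝓘(ℝ, Wk) 𝓘(ℝ, Fin (k - 1 + 1) → EM × F) ∞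
    (Subtype.val : L.jets k → HigherTangent (I.prod 𝓘(ℝ, F)) (TotalSpace F V) (k - 1)))
  {Wl : Type*} [NormedAddCommGroup Wl] [NormedSpace ℝ Wl] [ChartedSpace Wl (L.jets l)]
  [IsManifold 𝓘(ℝ, Wl) ∞ (L.jets l)]
  (hl : Manifold.IsSmoothEmbedding 𝓘(ℝ, Wl) 𝓘(ℝ, Fin (l - 1 + 1) → EM × F) ∞
    (Subtype.val : L.jets l → HigherTangent (I.prod 𝓘(ℝ, F)) (TotalSpace F V) (l - 1)))

include hk hl in
omit [CompleteSpace EM] in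
-- The smooth structures on `E^k` and `E^l` enter only through the embedding hypotheses: smoothness
-- into `E^l` is tested in `T^{l-1} E`, where the map is the smooth jet projection.
lemma contMDiff_jetsProj : ContMDiff 𝓘(ℝ, Wk) 𝓘(ℝ, Wl) ∞ (L.jetsProj h) := by
  intro q
  rw [hl.contMDiffAt_iff]
  exact ((HigherTangent.contMDiff_proj (Nat.sub_le_sub_right h 1)).comp hk.contMDiff).contMDiffAt

include hk hl in
omit [CompleteSpace EM] in
variable (p) in
lemma contMDiffOn_trivFun :
    ContMDiffOn 𝓘(ℝ, Wk) (𝓘(ℝ, Wl).prod 𝓘(ℝ, Φ)) ∞ (L.trivFun h Θ p)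
      {q | q.1.base ∈ (bundleChart (H := H) F V p).source} := by
  intro q hq
  refine ContMDiffAt.contMDiffWithinAt ?_
  refine ((L.contMDiff_jetsProj h hk hl).contMDiffAt).prodMk ?_
  have h1 := (contMDiffAt_of_mem_maximalAtlas (jetChart_mem_maximalAtlas (I := I) p (k - 1))
    (mem_jetChart_source.2 hq)).comp q hk.contMDiff.contMDiffAt
  exact (Θ.symm.contDiff.comp (tailCoord _).contDiff).contMDiff.contMDiffAt.comp q h1

include hk hl in
variable (p) in
-- After inclusion into `T^{k-1} E` and passage to natural coordinates, the map merges the free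
-- coordinates of the two factors and applies the smooth map `prolong`.
lemma contMDiffOn_trivInv :
    ContMDiffOn (𝓘(ℝ, Wl).prod 𝓘(ℝ, Φ)) 𝓘(ℝ, Wk) ∞ (L.trivInv h Θ p)
      {x | x.1.1.base ∈ (bundleChart (H := H) F V p).source} := by
  intro x hx
  have hbase : Continuous fun y : L.jets l × Φ => y.1.1.base :=
    HigherTangent.continuous_base.comp (continuous_subtype_val.comp continuous_fst)
  refine ContMDiffAt.contMDiffWithinAt ?_
  rw [hk.contMDiffAt_iff]
  have h1 : ContMDiffAt (𝓘(ℝ, Wl).prod 𝓘(ℝ, Φ)) 𝓘(ℝ, Fin (l - 1 + 1) → EM × F) ∞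
      (fun y : L.jets l × Φ => y.1.1.coord (bundleChart F V p)) x :=
    ContMDiffAt.comp (g := jetChart I F V p (l - 1)) x
      (contMDiffAt_of_mem_maximalAtlas (jetChart_mem_maximalAtlas (I := I) p (l - 1))
        (mem_jetChart_source.2 hx)) (hl.contMDiff.contMDiffAt.comp x contMDiffAt_fst)
  have h2 : ContMDiffAt (𝓘(ℝ, Wl).prod 𝓘(ℝ, Φ))
      𝓘(ℝ, (EM × (Fin (l - 1 + 1) → F)) × (Fin (k - 1 - (l - 1)) → F)) ∞
      (fun y : L.jets l × Φ =>
        (freeCoord EM F (l - 1) (y.1.1.coord (bundleChart F V p)), Θ y.2)) x :=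
    ((freeCoord EM F (l - 1)).contDiff.contMDiff.contMDiffAt.comp x h1).prodMk_space
      (Θ.contDiff.contMDiff.contMDiffAt.comp x contMDiffAt_snd)
  have h3 := (contDiff_mergeCoord (X := EM) (Y := F)
    (Nat.sub_le_sub_right h 1)).contMDiff.contMDiffAt.comp x h2
  have hdom : IsOpen {w : EM × (Fin (k - 1 + 1) → F) | (w.1, w.2 0) ∈ coordDomain I F V p} :=
    (isOpen_coordDomain p).preimage (by fun_prop)
  have h4 : ContMDiffAt (𝓘(ℝ, Wl).prod 𝓘(ℝ, Φ)) 𝓘(ℝ, Fin (k - 1 + 1) → EM × F) ∞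
      (fun y : L.jets l × Φ => L.fibreCoord h Θ p y.1 y.2) x := by
    refine ((contDiffOn_prolong (isOpen_coordDomain p) (L.contDiffOn_localField p)
      (k - 1)).contDiffAt (hdom.mem_nhds ?_)).contMDiffAt.comp x h3
    have := coord_zero_mem_coordDomain (I := I) hx
    simpa [mergeCoord] using this
  have h5 := (contMDiffAt_symm_of_mem_maximalAtlas
    (jetChart_mem_maximalAtlas (I := I) p (k - 1)) (L.fibreCoord_mem h Θ hx x.2)).comp x h4
  refine h5.congr_of_eventuallyEq ?_
  filter_upwards [((bundleChart F V p).open_source.preimage hbase).mem_nhds hx] with y hy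
  exact L.coe_trivInv h Θ hy

include hk hl in
lemma exists_trivialization (p : M) : ∃ e : Trivialization Φ (L.jetsProj h),
    e.baseSet = {b : L.jets l | b.1.base ∈ (bundleChart (H := H) F V p).source} ∧
    (∀ q, e q = L.trivFun h Θ p q) ∧
    (∀ x, e.toOpenPartialHomeomorph.symm x = L.trivInv h Θ p x) ∧
    IsSmoothTrivialization 𝓘(ℝ, Wk) 𝓘(ℝ, Wl) 𝓘(ℝ, Φ) e := by
  have hopen : ∀ n, IsOpen {b : L.jets n | b.1.base ∈ (bundleChart (H := H) F V p).source} :=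
    fun n => (bundleChart F V p).open_source.preimage
      (HigherTangent.continuous_base.comp continuous_subtype_val)
  refine ⟨{
    toFun := L.trivFun h Θ p
    invFun := L.trivInv h Θ p
    source := {q : L.jets k | q.1.base ∈ (bundleChart (H := H) F V p).source}
    target := {b : L.jets l | b.1.base ∈ (bundleChart (H := H) F V p).source} ×ˢ univ
    map_source' := fun q hq => ⟨by
      change (L.jetsProj h q).1.base ∈ (bundleChart (H := H) F V p).source
      rw [base_jetsProj]
      exact hq, mem_univ _⟩
    map_target' := fun x hx => L.base_trivInv_mem h Θ hx.1
    left_inv' := fun q hq => L.trivInv_trivFun h Θ hq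
    right_inv' := fun x hx => L.trivFun_trivInv h Θ hx.1
    open_source := hopen k
    open_target := (hopen l).prod isOpen_univ
    continuousOn_toFun := (L.contMDiffOn_trivFun h Θ p hk hl).continuousOn
    continuousOn_invFun := (L.contMDiffOn_trivInv h Θ p hk hl).continuousOn.mono fun x hx => hx.1
    baseSet := {b : L.jets l | b.1.base ∈ (bundleChart (H := H) F V p).source}
    open_baseSet := hopen l
    source_eq := by
      ext q
      change q.1.base ∈ (bundleChart (H := H) F V p).source ↔
        (L.jetsProj h q).1.base ∈ (bundleChart (H := H) F V p).source
      rw [base_jetsProj]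
    target_eq := rfl
    proj_toFun := fun q _ => rfl }, rfl, fun _ => rfl, fun _ => rfl, ?_, ?_⟩
  · exact L.contMDiffOn_trivFun h Θ p hk hl
  · exact (L.contMDiffOn_trivInv h Θ p hk hl).mono fun x hx => hx.1

end Trivialization

end LieAlgebroid

/-! ### The affine structure of the fibres -/

namespace LieAlgebroid

variable {EM : Type*} [NormedAddCommGroup EM] [NormedSpace ℝ EM]
  {H : Type*} [TopologicalSpace H] {I : ModelWithCorners ℝ EM H}
  {M : Type*} [TopologicalSpace M] [ChartedSpace H M] [IsManifold I ∞ M]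
  {F : Type*} [NormedAddCommGroup F] [NormedSpace ℝ F]
  {V : M → Type*} [TopologicalSpace (TotalSpace F V)]
  [∀ x, AddCommGroup (V x)] [∀ x, Module ℝ (V x)] [∀ x, TopologicalSpace (V x)]
  [FiberBundle F V] [VectorBundle ℝ F V] (L : LieAlgebroid I F V)
  [I.Boundaryless] [ContMDiffVectorBundle ∞ F V I] [CompleteSpace EM]
  {Φ : Type*} [NormedAddCommGroup Φ] [NormedSpace ℝ Φ]
  {l : ℕ} (hl : 0 < l) (Θ : Φ ≃L[ℝ] (Fin (l + 1 - 1 - (l - 1)) → F))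

include hl in
-- Along the fibre over `b` all derivatives of order less than l are constant, and so is the x-part
-- of order l, which they determine. In the bundle chart at `p` the top derivative is therefore
-- (constant, `Θ v`), affine in v. Positivity of l makes the passage to an arbitrary chart `e`
-- affine in this derivative.
lemma isAffineIntoFibre_trivInv {p : M} {b : L.jets l}
    (hb : b.1.base ∈ (bundleChart (H := H) F V p).source) :
    IsAffineIntoFibre fun v : Φ => (L.trivInv l.le_succ Θ p (b, v)).1 := by
  intro e he hbase
  have hp := bundleChart_mem_maximalAtlas (I := I) (F := F) (V := V) p
  set c : Φ → Fin (l + 1 - 1 + 1) → EM × F := L.fibreCoord l.le_succ Θ p b with hc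
  have hlow : ∀ v w, ∀ i, i ≠ Fin.last (l + 1 - 1) → c v i = c w i := by
    intro v w i hi
    have hi' : (i : ℕ) < l - 1 + 1 := by
      have h1 := i.2
      have h2 : (i : ℕ) ≠ l + 1 - 1 := fun h => hi (Fin.ext h)
      omega
    exact congrFun ((L.fibreCoord_castLE l.le_succ Θ hb v).trans
      (L.fibreCoord_castLE l.le_succ Θ hb w).symm) ⟨i, hi'⟩
  have hlast : ∀ v, c v (Fin.last _) =
      ((c 0 (Fin.last _)).1, Θ v ⟨0, by omega⟩) := by
    intro v
    refine Prod.ext ?_ ?_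
    · exact (isProlonged_prolong _ _ _).fst_last_eq (by omega) (isProlonged_prolong _ _ _)
        (hlow v 0)
    · have h1 := congrFun (tailCoord_prolong_mergeCoord (Nat.sub_le_sub_right l.le_succ 1)
        (L.localField p) (freeCoord EM F (l - 1) (b.1.coord (bundleChart F V p))) (Θ v))
        ⟨0, by omega⟩
      rw [← h1]
      change _ = (c v ⟨l - 1 + 1 + 0, _⟩).2
      congr 2
      exact Fin.ext (by simp only [Fin.val_last]; omega)
  obtain ⟨T, hT⟩ := exists_affine_changeCoord (r := l + 1 - 1)
    (fun x => (I.prod 𝓘(ℝ, F)) (e ((bundleChart F V p).symm ((I.prod 𝓘(ℝ, F)).symm x))))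
    (by omega) (c 0)
  refine ⟨T.comp ((AffineMap.const ℝ Φ (c 0 (Fin.last _)).1).prod
    ((LinearMap.proj (⟨0, by omega⟩ : Fin (l + 1 - 1 - (l - 1)))).comp
      Θ.toLinearEquiv.toLinearMap).toAffineMap), fun v => ?_⟩
  rw [HigherTangent.coord_change hp he (L.base_trivInv_mem l.le_succ Θ (x := (b, v)) hb) (hbase v),
    L.coord_trivInv l.le_succ Θ (x := (b, v)) hb]
  change changeCoord _ _ (c v) _ = _
  rw [hT _ (hlow v 0), hlast v]
  rfl

include hl in
-- The trivialization at `p'` reads the y-part of the top derivative in another bundle chart, so the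
-- previous lemma applies with that chart as `e`.
lemma exists_affine_trivFun_trivInv {p p' : M} {b : L.jets l}
    (hb : b.1.base ∈ (bundleChart (H := H) F V p).source)
    (hb' : b.1.base ∈ (bundleChart (H := H) F V p').source) :
    ∃ T : Φ →ᵃ[ℝ] Φ, ∀ v,
      L.trivFun l.le_succ Θ p' (L.trivInv l.le_succ Θ p (b, v)) = (b, T v) := by
  have hbase : ∀ v, (L.trivInv l.le_succ Θ p (b, v)).1.base ∈
      (bundleChart (H := H) F V p').source := fun v => by
    rw [← L.base_jetsProj l.le_succ, L.jetsProj_trivInv l.le_succ Θ (x := (b, v)) hb]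
    exact hb'
  obtain ⟨T, hT⟩ := L.isAffineIntoFibre_trivInv hl Θ hb (bundleChart F V p')
    (bundleChart_mem_maximalAtlas p') hbase
  -- The tail consists of the single derivative of order l, so a constant family over its index set
  -- represents it.
  refine ⟨((Θ.symm.toLinearEquiv.toLinearMap.comp
    (LinearMap.pi fun _ => LinearMap.snd ℝ EM F)).toAffineMap).comp T, fun v => ?_⟩
  rw [trivFun, L.jetsProj_trivInv l.le_succ Θ (x := (b, v)) hb]
  refine Prod.ext rfl ?_
  change Θ.symm _ = Θ.symm _
  congr 1
  funext j
  change _ = (T v).2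
  rw [← hT v]
  change ((L.trivInv l.le_succ Θ p (b, v)).1.coord (bundleChart F V p') ⟨l - 1 + 1 + j, _⟩).2 = _
  congr 2
  have := j.2
  exact Fin.ext (by simp only [Fin.val_last]; omega)

include hl in
lemma exists_affineEquiv_trivFun_trivInv {p p' : M} {b : L.jets l}
    (hb : b.1.base ∈ (bundleChart (H := H) F V p).source)
    (hb' : b.1.base ∈ (bundleChart (H := H) F V p').source) :
    ∃ T : Φ ≃ᵃ[ℝ] Φ, ∀ v,
      L.trivFun l.le_succ Θ p' (L.trivInv l.le_succ Θ p (b, v)) = (b, T v) := by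
  -- The affine maps for the two directions are mutually inverse. Stated for an arbitrary pair of
  -- charts, one computation yields both injectivity and surjectivity.
  have key : ∀ {p p' : M} (_ : b.1.base ∈ (bundleChart (H := H) F V p).source)
      (_ : b.1.base ∈ (bundleChart (H := H) F V p').source) {T T' : Φ →ᵃ[ℝ] Φ}
      (_ : ∀ v, L.trivFun l.le_succ Θ p' (L.trivInv l.le_succ Θ p (b, v)) = (b, T v))
      (_ : ∀ v, L.trivFun l.le_succ Θ p (L.trivInv l.le_succ Θ p' (b, v)) = (b, T' v)),
      Function.LeftInverse T' T := by
    intro p p' hb hb' T T' hT hT' v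
    have hbase : (L.trivInv l.le_succ Θ p (b, v)).1.base ∈
        (bundleChart (H := H) F V p').source := by
      rw [← L.base_jetsProj l.le_succ, L.jetsProj_trivInv l.le_succ Θ (x := (b, v)) hb]
      exact hb'
    have h1 := hT' (T v)
    rw [← hT v, L.trivInv_trivFun l.le_succ Θ hbase,
      L.trivFun_trivInv l.le_succ Θ (x := (b, v)) hb] at h1
    exact (congrArg Prod.snd h1).symm
  obtain ⟨T, hT⟩ := L.exists_affine_trivFun_trivInv hl Θ hb hb'
  obtain ⟨T', hT'⟩ := L.exists_affine_trivFun_trivInv hl Θ hb' hb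
  exact ⟨AffineEquiv.ofBijective (φ := T) ⟨(key hb hb' hT hT').injective,
    (key hb' hb hT' hT).surjective⟩, hT⟩

end LieAlgebroid

end

/-! ### Assembly of the theorem. -/

theorem mainTheorem6
    {EM : Type*} [NormedAddCommGroup EM] [NormedSpace ℝ EM] [FiniteDimensional ℝ EM]
    {H : Type*} [TopologicalSpace H] (I : ModelWithCorners ℝ EM H) [I.Boundaryless]
    (M : Type*) [TopologicalSpace M] [T2Space M] [SecondCountableTopology M]
    [ChartedSpace H M] [IsManifold I ∞ M]
    (F : Type*) [NormedAddCommGroup F] [NormedSpace ℝ F] [FiniteDimensional ℝ F]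
    (V : M → Type*) [TopologicalSpace (TotalSpace F V)]
    [∀ x, AddCommGroup (V x)] [∀ x, Module ℝ (V x)] [∀ x, TopologicalSpace (V x)]
    [FiberBundle F V] [VectorBundle ℝ F V] [ContMDiffVectorBundle ∞ F V I]
    (L : LieAlgebroid I F V) :
    -- smooth structures on the sets `E^k`, of dimension `dim M + k * rank E`
    ∃ cs : ∀ k : ℕ, 0 < k →
        ChartedSpace (EuclideanSpace ℝ (Fin (finrank ℝ EM + k * finrank ℝ F))) (L.jets k),
      -- for which `E^k` is a submanifold of `T^{k-1} E`
      (∀ (k : ℕ) (hk : 0 < k),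
        letI := cs k hk
        T2Space (L.jets k) ∧ SecondCountableTopology (L.jets k) ∧
        IsManifold (𝓡 (finrank ℝ EM + k * finrank ℝ F)) ∞ (L.jets k) ∧
        Manifold.IsSmoothEmbedding (𝓡 (finrank ℝ EM + k * finrank ℝ F))
          𝓘(ℝ, Fin (k - 1 + 1) → EM × F) ∞
          (Subtype.val :
            L.jets k → HigherTangent (I.prod 𝓘(ℝ, F)) (TotalSpace F V) (k - 1))) ∧
      -- `τ_{k,l}` is a smooth fibre bundle
      (∀ (k l : ℕ) (hl : 0 < l) (hlk : l < k),
        letI := cs k (hl.trans hlk)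
        letI := cs l hl
        IsSmoothFibreBundle (𝓡 (finrank ℝ EM + k * finrank ℝ F))
          (𝓡 (finrank ℝ EM + l * finrank ℝ F)) 𝓘(ℝ, Fin (k - l) → F) (Fin (k - l) → F)
          (L.jetsProj hlk.le)) ∧
      -- `τ_{l+1,l}` is an affine bundle, whose fibres are affine subspaces of those of
      -- `T^l E → T^{l-1} E`
      (∀ (l : ℕ) (hl : 0 < l),
        letI := cs (l + 1) l.succ_pos
        letI := cs l hl
        ∃ A : Set (Trivialization F (L.jetsProj l.le_succ)),
          IsAffineBundleAtlas (𝓡 (finrank ℝ EM + (l + 1) * finrank ℝ F))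
            (𝓡 (finrank ℝ EM + l * finrank ℝ F)) A ∧
          ∀ e ∈ A, ∀ b ∈ e.baseSet, IsAffineIntoFibre fun v : F =>
            (e.toOpenPartialHomeomorph.symm (b, v)).val) := by
  have : CompleteSpace EM := FiniteDimensional.complete ℝ EM
  -- The free coordinates of a (k-1)-jet have the asserted dimension, using k - 1 + 1 = k for
  -- positive k; any linear isomorphism then moves the charts to Euclidean space.
  have hdim : ∀ k : ℕ, 0 < k → finrank ℝ (EM × (Fin (k - 1 + 1) → F)) =
      finrank ℝ (EuclideanSpace ℝ (Fin (finrank ℝ EM + k * finrank ℝ F))) := fun k hk => by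
    rw [finrank_prod, finrank_pi_fintype, finrank_euclideanSpace_fin]
    simp [Nat.sub_add_cancel hk]
  let D := fun (k : ℕ) (hk : 0 < k) =>
    L.jetsSliceData k (ContinuousLinearEquiv.ofFinrankEq (hdim k hk))
  have hsmooth : ∀ (k : ℕ) (hk : 0 < k), letI := (D k hk).chartedSpace
      IsManifold (𝓡 (finrank ℝ EM + k * finrank ℝ F)) ∞ (L.jets k) ∧
        Manifold.IsSmoothEmbedding (𝓡 (finrank ℝ EM + k * finrank ℝ F))
          𝓘(ℝ, Fin (k - 1 + 1) → EM × F) ∞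
          (Subtype.val :
            L.jets k → HigherTangent (I.prod 𝓘(ℝ, F)) (TotalSpace F V) (k - 1)) :=
    fun k hk => ⟨(D k hk).isManifold, (D k hk).isSmoothEmbedding⟩
  refine ⟨fun k hk => (D k hk).chartedSpace, fun k hk => ?_, fun k l hl hlk => ?_, fun l hl => ?_⟩
  · have h2 := LieAlgebroid.t2Space_higherTangent (I := I) (F := F) (V := V) (k - 1)
    have h3 := LieAlgebroid.secondCountableTopology_higherTangent (I := I) (F := F) (V := V) (k - 1)
    -- `E^k` carries the subspace topology, so both topological properties are inherited from
    -- `T^{k-1} E`.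
    exact ⟨inferInstance, inferInstance, hsmooth k hk⟩
  · let _ := (D k (hl.trans hlk)).chartedSpace
    let _ := (D l hl).chartedSpace
    obtain ⟨_, hk'⟩ := hsmooth k (hl.trans hlk)
    obtain ⟨_, hl'⟩ := hsmooth l hl
    refine ⟨L.contMDiff_jetsProj hlk.le hk' hl', L.jetsProj_surjective hlk.le, fun b => ?_⟩
    -- Free derivatives are counted in jet orders, k - 1 and l - 1; with truncated subtraction the
    -- difference equals k - l because l is positive.
    have hkl : k - 1 - (l - 1) = k - l := by omega
    obtain ⟨e, he, -, -, hsm⟩ := L.exists_trivialization hlk.le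
      (LinearEquiv.funCongrLeft ℝ F (finCongr hkl)).toContinuousLinearEquiv hk' hl' b.1.base.proj
    refine ⟨e, ?_, hsm⟩
    rw [he]
    exact mem_bundleChart_source b.1.base
  · let _ := (D (l + 1) l.succ_pos).chartedSpace
    let _ := (D l hl).chartedSpace
    obtain ⟨_, hk'⟩ := hsmooth (l + 1) l.succ_pos
    obtain ⟨_, hl'⟩ := hsmooth l hl
    have hunique : l + 1 - 1 - (l - 1) = 1 := by omega
    let Θ : F ≃L[ℝ] (Fin (l + 1 - 1 - (l - 1)) → F) :=
      ((LinearEquiv.funUnique (Fin 1) ℝ F).symm.trans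
        (LinearEquiv.funCongrLeft ℝ F (finCongr hunique))).toContinuousLinearEquiv
    -- One trivialization for each point of `M`; together they form the bundle atlas.
    choose e hbase hfun hsymm hsm using L.exists_trivialization l.le_succ Θ hk' hl'
    refine ⟨range e, ⟨fun b => ⟨_, ⟨b.1.base.proj, rfl⟩, ?_⟩, ?_, ?_⟩, ?_⟩
    · rw [hbase]
      exact mem_bundleChart_source b.1.base
    · rintro _ ⟨p, rfl⟩
      exact hsm p
    · rintro _ ⟨p, rfl⟩ _ ⟨p', rfl⟩ b ⟨hb, hb'⟩
      rw [hbase] at hb hb'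
      obtain ⟨T, hT⟩ := L.exists_affineEquiv_trivFun_trivInv hl Θ hb hb'
      refine ⟨T, fun v => ?_⟩
      rw [hsymm, hfun]
      exact hT v
    · rintro _ ⟨p, rfl⟩ b hb
      rw [hbase] at hb
      simp only [hsymm]
      exact L.isAffineIntoFibre_trivInv hl Θ hb
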